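/- Fix $n$. Let $\nu$ be a Lévy measure on $\mathbb{R}^n$ concentrated on $\mathbb{Z}^n\setminus\{0\}$ with $\int\min(1,\|y\|)\,\nu(dy)<\infty$, let $N$ be a Poisson random measure on $\mathbb{R}^n\times[0,1]\times\mathbb{R}$ with intensity $\nu(dy)\,dx\,ds$, and let $L(B)=(L^{(1)}(B),\dots,L^{(n)}(B))^\top=\int_{\mathbb{R}^n\times B}y\,N(dy,dx,ds)$ be the associated homogeneous $\mathbb{Z}^n$-valued Lévy basis. The cumulant function of its Lévy seed $L'$ is $C_{L'}(\theta)=\int_{\mathbb{R}^n}(e^{i\theta^\top y}-1)\,\nu(dy)$. A trawl is a Borel set $A\subset[0,1]\times(-\infty,0]$ of finite Lebesgue measure, $A_t=A+(0,t)$, and the trawl process with trawls $A^{(1)},\dots,A^{(n)}$ is $Y_t=(L^{(1)}(A^{(1)}_t),\dots,L^{(n)}(A^{(n)}_t))^\top$, $t\in\mathbb{R}$. (1) If $A^{(1)}=\dots=A^{(n)}=A$, then for all $t\in\mathbb{R}$ and $\theta\in\mathbb{R}^n$, $$\mathbb{E}\exp(i\theta^\top Y_t)=\exp\bigl(\mathrm{Leb}(A)\,C_{L'}(\theta)\bigr).$$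 (2) Call a probability law $\pi$ on $\mathbb{Z}^n$ infinitely divisible if for every integer $m\ge1$ it is the law of a sum of $m$ independent identically distributed $\mathbb{Z}^n$-valued random vectors. For every infinitely divisible law $\pi$ on $\mathbb{Z}^n$ and every trawl $A$ with $\mathrm{Leb}(A)>0$, there exist a probability space, a measure $\nu$ and a Poisson random measure $N$ as above such that the trawl process with $A^{(1)}=\dots=A^{(n)}=A$ is strictly stationary and $Y_t$ has law $\pi$ for every $t\in\mathbb{R}$. In particular, every infinitely divisible integer-valued law is the marginal law of a stationary integer-valued trawl process. -/

import Mathlib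

open MeasureTheory ProbabilityTheory Set Function
open scoped NNReal ENNReal unitInterval

noncomputable section

/-- The inclusion of the integer lattice `ℤⁿ` into Euclidean space `ℝⁿ`. -/
def intVec (n : ℕ) (k : Fin n → ℤ) : EuclideanSpace ℝ (Fin n) :=
  WithLp.toLp 2 (fun i => (k i : ℝ))

/-- A Lévy measure on `ℝⁿ`: no mass at the origin and `∫ min(1, ‖y‖²) ν(dy) < ∞`. -/
def IsLevyMeasure {n : ℕ} (ν : Measure (EuclideanSpace ℝ (Fin n))) : Prop :=
  ν {0} = 0 ∧ ∫⁻ y, min 1 (‖y‖ₑ ^ 2) ∂ν < ∞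

/-- A Lévy measure concentrated on `ℤⁿ \ {0}` with `∫ min(1, ‖y‖) ν(dy) < ∞`. -/
structure IsIntegerLevyMeasure {n : ℕ} (ν : Measure (EuclideanSpace ℝ (Fin n))) : Prop where
  isLevy : IsLevyMeasure ν
  concentrated : ν (range (intVec n) \ {0})ᶜ = 0
  lintegral_lt_top : ∫⁻ y, min 1 ‖y‖ₑ ∂ν < ∞

/-- `N` is a Poisson random measure on `E` with intensity measure `μ`, on the probability space
`(Ω, P)`: a random measure with values in `{0, 1, 2, …, ∞}` such that `N(B)` is Poisson distributed
with mean `μ(B)` (almost surely infinite if `μ(B) = ∞`), and such that the values on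
disjoint sets are independent. -/
structure IsPoissonRandomMeasure {Ω E : Type*} [MeasurableSpace Ω] [MeasurableSpace E]
    (μ : Measure E) (N : Ω → Measure E) (P : Measure Ω) : Prop where
  measurable : ∀ B, MeasurableSet B → Measurable (fun ω => N ω B)
  integer : ∀ ω B, MeasurableSet B → ∃ k : ℕ∞, N ω B = (k : ℝ≥0∞)
  law_of_finite : ∀ B, MeasurableSet B → μ B < ∞ →
    P.map (fun ω => N ω B) =
      (poissonMeasure (μ B).toNNReal).map (fun k : ℕ => (k : ℝ≥0∞))
  law_of_infinite : ∀ B, MeasurableSet B → μ B = ∞ → ∀ᵐ ω ∂P, N ω B = ∞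
  indep : ∀ (k : ℕ) (B : Fin k → Set E), (∀ i, MeasurableSet (B i)) →
    Pairwise (Disjoint on B) → iIndepFun (fun i ω => N ω (B i)) P

/-- The jump space `ℝⁿ × [0,1] × ℝ`. -/
abbrev JumpSpace (n : ℕ) : Type := EuclideanSpace ℝ (Fin n) × (I × ℝ)

/-- The intensity measure `ν(dy) dx ds` on `ℝⁿ × [0,1] × ℝ`. -/
def jumpIntensity {n : ℕ} (ν : Measure (EuclideanSpace ℝ (Fin n))) : Measure (JumpSpace n) :=
  ν.prod (volume : Measure (I × ℝ))

/-- The homogeneous Lévy basis `L(B) = ∫_{ℝⁿ × B} y N(dy, dx, ds)`. -/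
def levyBasis {n : ℕ} {Ω : Type*} (N : Ω → Measure (JumpSpace n)) (B : Set (I × ℝ)) (ω : Ω) :
    EuclideanSpace ℝ (Fin n) :=
  ∫ p in univ ×ˢ B, p.1 ∂(N ω)

/-- The cumulant function of the Lévy seed, `C(θ) = ∫ (exp(i θᵀ y) - 1) ν(dy)`. -/
def seedCumulant {n : ℕ} (ν : Measure (EuclideanSpace ℝ (Fin n)))
    (θ : EuclideanSpace ℝ (Fin n)) : ℂ :=
  ∫ y, (Complex.exp (Complex.I * ((inner ℝ θ y : ℝ) : ℂ)) - 1) ∂ν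

/-- A trawl: a Borel subset of `[0,1] × (-∞, 0]` of finite Lebesgue measure. -/
structure IsTrawl (A : Set (I × ℝ)) : Prop where
  measurableSet : MeasurableSet A
  nonpos : ∀ p ∈ A, p.2 ≤ 0
  volume_lt_top : volume A < ∞

/-- The shifted trawl `A_t = A + (0, t)`. -/
def trawlAt (A : Set (I × ℝ)) (t : ℝ) : Set (I × ℝ) :=
  {p | (p.1, p.2 - t) ∈ A}

/-- The trawl process `Y_t = (L⁽¹⁾(A_t⁽¹⁾), …, L⁽ⁿ⁾(A_t⁽ⁿ⁾))`. -/
def trawlProcess {n : ℕ} {Ω : Type*} (N : Ω → Measure (JumpSpace n))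
    (A : Fin n → Set (I × ℝ)) (t : ℝ) (ω : Ω) : EuclideanSpace ℝ (Fin n) :=
  WithLp.toLp 2 (fun i => levyBasis N (trawlAt (A i) t) ω i)

/-- Strict stationarity of a process indexed by `ℝ`: the finite-dimensional distributions are
invariant under time shifts. -/
def IsStationaryProcess {Ω S : Type*} [MeasurableSpace Ω] [MeasurableSpace S]
    (Y : ℝ → Ω → S) (P : Measure Ω) : Prop :=
  (∀ t, AEMeasurable (Y t) P) ∧
    ∀ (k : ℕ) (t : Fin k → ℝ) (h : ℝ),
      P.map (fun ω i => Y (t i + h) ω) = P.map (fun ω i => Y (t i) ω)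

/-- Infinite divisibility of an integer-valued law: for every `m ≥ 1`, `π` is the law of the sum of
`m` independent, identically distributed `ℤⁿ`-valued random vectors. -/
def IsInfinitelyDivisibleInt {n : ℕ} (π : Measure (Fin n → ℤ)) : Prop :=
  ∀ m : ℕ, 1 ≤ m → ∃ ρ : Measure (Fin n → ℤ), IsProbabilityMeasure ρ ∧
    π = (Measure.pi (fun _ : Fin m => ρ)).map (fun x => ∑ j, x j)

end

/-! The characteristic function of a Poisson integral settles the marginals and stationarity;
realising every infinitely divisible law also needs a lattice Lévy–Khintchine theorem and the
existence of Poisson random measures.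

A law `π` on the lattice with convolution roots `ρ m` is compound Poisson
(`exists_compoundPoisson`). Near the origin the characteristic function of `π` is close to 1 in
modulus, so the symmetrized roots have characteristic functions within `O(1/m)` of 1. Distinct
integers differ by at least 1, hence two independent draws from `ρ m` differ with probability
`O(1/m)`, and `ρ m` has an atom carrying all but `O(1/m)` of its mass. For large `m` this atom is
the origin, as otherwise `π` would keep a fixed positive mass at distance at least `m`. Thus `m • ρ
m` off the origin is bounded and tight. A limit `η` along an ultrafilter exists, and `(1 + z/m)^m →
exp z` identifies the characteristic function of `π` as `exp ∫ (e^{iθᵀk} - 1) dη`.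

Poisson random measures arise by superposing independent Poisson samples, one for each term of a
decomposition of the intensity into finite measures; laws and independence pass to the increasing
limit.

An integer Lévy measure is finite, so over a trawl the Lévy basis is almost surely a finite sum of
independent Poisson counts times lattice vectors. The resulting joint characteristic function
(`integral_exp_sum_levyBasis`) depends on the sets only through an integral against the intensity.
Its product structure gives the factor `Leb(A)`, and its invariance under time shifts gives
stationarity. Taking for `ν` the image of `η / Leb(A)` realises `π`. -/

/-! ### Lévy–Khintchine representation on the integer lattice -/

section LevyKhintchine

open Filter Topology

lemma measurable_intVec (n : ℕ) : Measurable (intVec n) := measurable_of_countable _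

lemma intVec_sum (n : ℕ) {ι : Type*} (s : Finset ι) (x : ι → Fin n → ℤ) :
    intVec n (∑ j ∈ s, x j) = ∑ j ∈ s, intVec n (x j) := by
  ext i
  simp [intVec]

lemma charFun_map_intVec {n : ℕ} (ρ : Measure (Fin n → ℤ)) (θ : EuclideanSpace ℝ (Fin n)) :
    charFun (ρ.map (intVec n)) θ =
      ∫ k, Complex.exp (Complex.I * ((inner ℝ θ (intVec n k) : ℝ) : ℂ)) ∂ρ := by
  rw [charFun_apply, integral_map (measurable_intVec n).aemeasurable (by fun_prop)]
  refine integral_congr_ae (ae_of_all _ fun k => ?_)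
  simp only [real_inner_comm, mul_comm]

/-- The characteristic function of an `m`-fold convolution power. -/
lemma charFun_map_intVec_sum {n m : ℕ} (ρ : Measure (Fin n → ℤ)) [IsProbabilityMeasure ρ]
    (θ : EuclideanSpace ℝ (Fin n)) :
    charFun (((Measure.pi (fun _ : Fin m => ρ)).map (fun x => ∑ j, x j)).map (intVec n)) θ =
      charFun (ρ.map (intVec n)) θ ^ m := by
  have hm := measurable_intVec n
  have : IsProbabilityMeasure (ρ.map (intVec n)) := Measure.isProbabilityMeasure_map hm.aemeasurable
  have h := congrFun (charFun_map_sum_pi_eq_prod (fun _ : Fin m => ρ.map (intVec n))) θ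
  rw [Measure.map_map hm (by fun_prop)]
  rw [← Measure.pi_map_pi (fun _ => hm.aemeasurable), Measure.map_map (by fun_prop) (by fun_prop)] at h
  simp only [Finset.prod_const, Finset.card_univ, Fintype.card_fin, Pi.pow_apply] at h
  rw [← h]
  congr 2
  ext x : 1
  simp [intVec_sum]

/-- The law of the difference of the `i`-th coordinates of two independent copies. -/
lemma charFun_coord_sub {n : ℕ} (ρ : Measure (Fin n → ℤ)) [IsProbabilityMeasure ρ] (i : Fin n)
    (t : ℝ) :
    charFun ((ρ.prod ρ).map (fun p => ((p.1 i - p.2 i : ℤ) : ℝ))) t =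
      ((‖charFun (ρ.map (intVec n)) (t • EuclideanSpace.single i 1)‖ ^ 2 : ℝ) : ℂ) := by
  have hm := measurable_intVec n
  have h1 : ∀ k : Fin n → ℤ, (inner ℝ (t • EuclideanSpace.single i (1:ℝ)) (intVec n k) : ℝ)
      = t * k i := by
    intro k
    rw [inner_smul_left, EuclideanSpace.inner_single_left]
    simp [intVec]
  have h2 : charFun (ρ.map (intVec n)) (t • EuclideanSpace.single i 1) =
      ∫ k, Complex.exp (Complex.I * (t * k i : ℝ)) ∂ρ := by
    simp_rw [charFun_map_intVec, h1]
  have h3 : (starRingEnd ℂ) (charFun (ρ.map (intVec n)) (t • EuclideanSpace.single i 1)) =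
      ∫ k, Complex.exp (-(Complex.I * (t * k i : ℝ))) ∂ρ := by
    rw [h2, ← integral_conj]
    refine integral_congr_ae (ae_of_all _ fun k => ?_)
    simp [← Complex.exp_conj]
  rw [Complex.ofReal_pow, ← Complex.mul_conj', h3, h2, ← integral_prod_mul, charFun_apply_real,
    integral_map (by fun_prop) (by fun_prop)]
  refine integral_congr_ae (ae_of_all _ fun p => ?_)
  simp only [← Complex.exp_add]
  congr 1
  push_cast
  ring

/-- Taking roots gives `s ≥ e^{-ε/m}`, hence `s² ≥ e^{-2ε/m} ≥ 1 - 2ε/m`. With `s` the modulus of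
the characteristic function of an `m`-th root, `s²` is that of the symmetrized root. -/
lemma one_sub_sq_le_of_exp_le_pow {s ε : ℝ} {m : ℕ} (hm : 1 ≤ m) (hs : 0 ≤ s)
    (h : Real.exp (-ε) ≤ s ^ m) : m * (1 - s ^ 2) ≤ 2 * ε := by
  have hm' : (0 : ℝ) < m := by exact_mod_cast hm
  have h1 : Real.exp (-ε / m) ≤ s := by
    by_contra! hlt
    have := pow_lt_pow_left₀ hlt hs (by omega : m ≠ 0)
    rw [← Real.exp_nat_mul, mul_div_cancel₀ _ hm'.ne'] at this
    linarith
  have h2 : 1 - 2 * ε / m ≤ s ^ 2 := by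
    calc 1 - 2 * ε / m ≤ Real.exp (-(2 * ε / m)) := Real.one_sub_le_exp_neg _
      _ = Real.exp (-ε / m) ^ 2 := by rw [← Real.exp_nat_mul]; congr 1; push_cast; ring
      _ ≤ s ^ 2 := pow_le_pow_left₀ (Real.exp_nonneg _) h1 2
  calc m * (1 - s ^ 2) ≤ m * (2 * ε / m) := by gcongr; linarith
    _ = 2 * ε := by field_simp

variable {n : ℕ}

/-- If `φ` is continuous at `0`, the `m`-th roots of `φ` have symmetrizations with uniformly
small tails. -/
lemma exists_tail_bound {φ : EuclideanSpace ℝ (Fin n) → ℂ} (hc : Continuous φ) (h0 : φ 0 = 1)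
    (i : Fin n) {ε : ℝ} (hε : 0 < ε) :
    ∃ R : ℝ, 0 < R ∧ (∀ t : ℝ, |t| ≤ 2 * R⁻¹ →
        Real.exp (-ε) ≤ ‖φ (t • EuclideanSpace.single i 1)‖) ∧
      ∀ (m : ℕ) (ρ : Measure (Fin n → ℤ)), 1 ≤ m → IsProbabilityMeasure ρ →
      (∀ θ, φ θ = charFun (ρ.map (intVec n)) θ ^ m) →
      m * (ρ.prod ρ).real {p | R < |((p.1 i - p.2 i : ℤ) : ℝ)|} ≤ 4 * ε := by
  have hcont : Continuous (fun t : ℝ => ‖φ (t • EuclideanSpace.single i 1)‖) := by fun_prop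
  have hev : ∀ᶠ t : ℝ in 𝓝 0, Real.exp (-ε) < ‖φ (t • EuclideanSpace.single i 1)‖ := by
    refine hcont.continuousAt.eventually (lt_mem_nhds ?_)
    simpa [h0] using hε
  obtain ⟨δ, hδ, hball⟩ := Metric.eventually_nhds_iff.1 hev
  -- The truncation inequality below integrates over `[-2/R, 2/R]`; with `R = 4/δ` this is `[-δ/2,
  -- δ/2]`, inside the ball where `φ` is controlled.
  have hR : (0 : ℝ) < 4 / δ := by positivity
  have hlow : ∀ t : ℝ, |t| ≤ 2 * (4 / δ)⁻¹ →
      Real.exp (-ε) ≤ ‖φ (t • EuclideanSpace.single i 1)‖ := by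
    intro t ht
    refine (hball ?_).le
    rw [Real.dist_eq, sub_zero]
    have : 2 * (4 / δ)⁻¹ = δ / 2 := by field_simp; norm_num
    linarith
  refine ⟨4 / δ, hR, hlow, ?_⟩
  set R := 4 / δ
  intro m ρ hm hρ hφ
  have hm' : (0 : ℝ) < m := by exact_mod_cast hm
  set τ := (ρ.prod ρ).map (fun p => ((p.1 i - p.2 i : ℤ) : ℝ)) with hτ
  have : IsProbabilityMeasure τ := Measure.isProbabilityMeasure_map (by fun_prop)
  have h1 := measureReal_abs_gt_le_integral_charFun (μ := τ) hR
  have h2 : τ.real {x | R < |x|} = (ρ.prod ρ).real {p | R < |((p.1 i - p.2 i : ℤ) : ℝ)|} := by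
    rw [hτ, map_measureReal_apply (by fun_prop) (measurableSet_lt (by fun_prop) (by fun_prop))]
    rfl
  have h3 : ‖∫ t in (-2 * R⁻¹)..(2 * R⁻¹), 1 - charFun τ t‖ ≤
      (2 * ε / m) * |2 * R⁻¹ - (-2 * R⁻¹)| := by
    refine intervalIntegral.norm_integral_le_of_norm_le_const fun t ht => ?_
    have hRi : 0 < R⁻¹ := inv_pos.2 hR
    rw [uIoc_of_le (by linarith)] at ht
    have ht' : |t| ≤ 2 * R⁻¹ := abs_le.2 ⟨by linarith [ht.1], ht.2⟩
    have h4 := hlow t ht'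
    rw [hφ, norm_pow] at h4
    have h5 := one_sub_sq_le_of_exp_le_pow hm (norm_nonneg _) h4
    have : IsProbabilityMeasure (ρ.map (intVec n)) :=
      Measure.isProbabilityMeasure_map (measurable_intVec n).aemeasurable
    have h6 := norm_charFun_le_one (μ := ρ.map (intVec n)) (t • EuclideanSpace.single i 1)
    have h7 : ‖charFun (ρ.map (intVec n)) (t • EuclideanSpace.single i 1)‖ ^ 2 ≤ 1 :=
      pow_le_one₀ (norm_nonneg _) h6
    rw [hτ, charFun_coord_sub, ← Complex.ofReal_one, ← Complex.ofReal_sub, Complex.norm_real,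
      Real.norm_of_nonneg (by linarith), le_div_iff₀ hm']
    linarith
  rw [← h2]
  have h8 : |2 * R⁻¹ - (-2 * R⁻¹)| = 4 * R⁻¹ := by
    rw [abs_of_nonneg] <;> [ring; (have := inv_pos.2 hR; linarith)]
  rw [h8] at h3
  calc m * τ.real {x | R < |x|} ≤ m * (2⁻¹ * R * (2 * ε / m * (4 * R⁻¹))) := by
        gcongr
        exact h1.trans (by gcongr)
    _ = 4 * ε := by field_simp

/-- The probability that two independent copies of an `m`-th root of `φ` differ is `O(1/m)`. -/
lemma exists_coord_ne_bound {φ : EuclideanSpace ℝ (Fin n) → ℂ} (hc : Continuous φ) (h0 : φ 0 = 1)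
    (i : Fin n) :
    ∃ C : ℝ, 0 ≤ C ∧ ∀ (m : ℕ) (ρ : Measure (Fin n → ℤ)), 1 ≤ m → IsProbabilityMeasure ρ →
      (∀ θ, φ θ = charFun (ρ.map (intVec n)) θ ^ m) →
      m * (ρ.prod ρ).real {p | p.1 i ≠ p.2 i} ≤ C := by
  obtain ⟨R, hR, hlow, htail⟩ := exists_tail_bound hc h0 i one_pos
  -- A nonzero difference `Z` with `|Z| ≤ R` satisfies `1 ≤ |Z|`, so this choice gives `t ≤ |tZ| ≤ 1
  -- < π` and `1 - cos (tZ) ≥ 1 - cos t > 0`. Differences beyond `R` are left to the tail bound with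
  -- `ε = 1`.
  set t : ℝ := min 1 R⁻¹ with ht
  have htpos : 0 < t := lt_min one_pos (inv_pos.2 hR)
  have htR : t * R ≤ 1 := by
    calc t * R ≤ R⁻¹ * R := by gcongr; exact min_le_right _ _
      _ = 1 := inv_mul_cancel₀ hR.ne'
  have ht1 : t ≤ 1 := min_le_left _ _
  have hpi := Real.pi_gt_three
  have hcos : 0 < 1 - Real.cos t := by
    have := Real.cos_lt_cos_of_nonneg_of_le_pi le_rfl (by linarith : t ≤ Real.pi) htpos
    rw [Real.cos_zero] at this
    linarith
  refine ⟨4 * 1 + (1 - Real.cos t)⁻¹ * 2, by positivity, fun m ρ hm hρ hφ => ?_⟩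
  have hm' : (0 : ℝ) < m := by exact_mod_cast hm
  have h1 := htail m ρ hm hρ hφ
  set Z : (Fin n → ℤ) × (Fin n → ℤ) → ℝ := fun p => ((p.1 i - p.2 i : ℤ) : ℝ) with hZ
  have hZm : Measurable Z := by fun_prop
  set A : Set ((Fin n → ℤ) × (Fin n → ℤ)) := {p | p.1 i ≠ p.2 i ∧ |Z p| ≤ R}
  have hAm : MeasurableSet A := MeasurableSet.of_discrete
  have hint : Integrable (fun p => 1 - Real.cos (t * Z p)) (ρ.prod ρ) := by
    refine Integrable.of_bound (by fun_prop) 2 (ae_of_all _ fun p => ?_)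
    rw [Real.norm_eq_abs, abs_le]
    constructor <;> linarith [Real.neg_one_le_cos (t * Z p), Real.cos_le_one (t * Z p)]
  have h2 : (1 - Real.cos t) * (ρ.prod ρ).real A ≤ ∫ p, (1 - Real.cos (t * Z p)) ∂(ρ.prod ρ) := by
    have : ∫ p, A.indicator (fun _ => 1 - Real.cos t) p ∂(ρ.prod ρ) =
        (1 - Real.cos t) * (ρ.prod ρ).real A := by
      rw [integral_indicator hAm, setIntegral_const, smul_eq_mul, mul_comm]
    rw [← this]
    refine integral_mono ((integrable_const _).indicator hAm) hint fun p => ?_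
    by_cases hp : p ∈ A
    · rw [indicator_of_mem hp]
      have h3 : (1 : ℝ) ≤ |Z p| := by
        rw [hZ, ← Int.cast_abs]
        exact_mod_cast Int.one_le_abs (sub_ne_zero.2 hp.1)
      have h4 : t ≤ |t * Z p| := by
        rw [abs_mul, abs_of_pos htpos]; nlinarith
      have h5 : |t * Z p| ≤ Real.pi := by
        rw [abs_mul, abs_of_pos htpos]
        have : t * |Z p| ≤ t * R := by gcongr; exact hp.2
        linarith
      have := Real.cos_le_cos_of_nonneg_of_le_pi htpos.le h5 h4
      rw [Real.cos_abs] at this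
      linarith
    · rw [indicator_of_notMem hp]
      linarith [Real.cos_le_one (t * Z p)]
  have h3 : m * ∫ p, (1 - Real.cos (t * Z p)) ∂(ρ.prod ρ) ≤ 2 := by
    have h4 : ∫ p, (1 - Real.cos (t * Z p)) ∂(ρ.prod ρ) =
        1 - ‖charFun (ρ.map (intVec n)) (t • EuclideanSpace.single i 1)‖ ^ 2 := by
      have h5 := congrArg Complex.re (charFun_coord_sub ρ i t)
      rw [Complex.ofReal_re, charFun_apply_real, integral_map (by fun_prop) (by fun_prop),
        ← RCLike.re_eq_complex_re, ← integral_re] at h5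
      · rw [← h5, integral_sub (integrable_const _)]
        · simp only [integral_const, probReal_univ, one_smul, RCLike.re_eq_complex_re]
          congr 2
          ext p
          rw [← Complex.ofReal_mul, Complex.exp_ofReal_mul_I_re]
        · refine Integrable.of_bound (by fun_prop) 1 (ae_of_all _ fun p => ?_)
          exact Real.abs_cos_le_one _
      · refine Integrable.of_bound (Measurable.aestronglyMeasurable (by fun_prop)) 1
          (ae_of_all _ fun p => ?_)
        rw [← Complex.ofReal_mul, Complex.norm_exp_ofReal_mul_I]
    rw [h4]
    have h6 := hlow t (by rw [abs_of_pos htpos]; linarith [min_le_right 1 R⁻¹, inv_pos.2 hR])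
    rw [hφ, norm_pow] at h6
    simpa using one_sub_sq_le_of_exp_le_pow hm (norm_nonneg _) h6
  have h4 : (ρ.prod ρ).real {p | p.1 i ≠ p.2 i} ≤
      (ρ.prod ρ).real {p | R < |Z p|} + (ρ.prod ρ).real A := by
    refine (measureReal_mono fun p hp => ?_).trans (measureReal_union_le _ _)
    by_cases h : R < |Z p|
    · exact Or.inl h
    · exact Or.inr ⟨hp, not_lt.1 h⟩
  have h5 : m * (ρ.prod ρ).real A ≤ (1 - Real.cos t)⁻¹ * 2 := by
    rw [inv_mul_eq_div, le_div_iff₀ hcos]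
    calc m * (ρ.prod ρ).real A * (1 - Real.cos t)
        = m * ((1 - Real.cos t) * (ρ.prod ρ).real A) := by ring
      _ ≤ m * ∫ p, (1 - Real.cos (t * Z p)) ∂(ρ.prod ρ) := by gcongr
      _ ≤ 2 := h3
  calc m * (ρ.prod ρ).real {p | p.1 i ≠ p.2 i}
      ≤ m * ((ρ.prod ρ).real {p | R < |Z p|} + (ρ.prod ρ).real A) := by gcongr
    _ ≤ _ := by rw [mul_add]; exact add_le_add h1 h5

/-- By Fubini, the probability that two independent draws differ is the `ρ`-average of `ρ {x}ᶜ`, so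
some `x` does no worse than the average. A union bound over coordinates controls that probability.
-/
lemma exists_singleton_compl_bound {φ : EuclideanSpace ℝ (Fin n) → ℂ} (hc : Continuous φ)
    (h0 : φ 0 = 1) :
    ∃ C : ℝ, 0 ≤ C ∧ ∀ (m : ℕ) (ρ : Measure (Fin n → ℤ)), 1 ≤ m → IsProbabilityMeasure ρ →
      (∀ θ, φ θ = charFun (ρ.map (intVec n)) θ ^ m) → ∃ x, m * ρ.real {x}ᶜ ≤ C := by
  choose C hC0 hC using exists_coord_ne_bound hc h0
  refine ⟨∑ i, C i, Finset.sum_nonneg fun i _ => hC0 i, fun m ρ hm hρ hφ => ?_⟩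
  have h1 : (ρ.prod ρ).real {p | p.1 ≠ p.2} ≤ ∑ i, (ρ.prod ρ).real {p | p.1 i ≠ p.2 i} := by
    refine (measureReal_mono (fun p hp => ?_) (measure_ne_top _ _)).trans
      (measureReal_biUnion_finset_le Finset.univ _)
    obtain ⟨i, hi⟩ := Function.ne_iff.1 (show p.1 ≠ p.2 from hp)
    simp only [mem_iUnion]
    exact ⟨i, Finset.mem_univ _, hi⟩
  obtain ⟨x, hx⟩ := exists_le_lintegral (μ := ρ)
    (f := fun x => ρ (Prod.mk x ⁻¹' {p | p.1 ≠ p.2})) (measurable_of_countable _).aemeasurable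
  rw [← Measure.prod_apply MeasurableSet.of_discrete] at hx
  have hx' : ρ.real {x}ᶜ ≤ (ρ.prod ρ).real {p | p.1 ≠ p.2} := by
    refine ENNReal.toReal_mono (measure_ne_top _ _) (le_trans (le_of_eq ?_) hx)
    congr 1
    ext y
    simp [eq_comm]
  refine ⟨x, ?_⟩
  calc m * ρ.real {x}ᶜ ≤ m * ∑ i, (ρ.prod ρ).real {p | p.1 i ≠ p.2 i} := by
        gcongr; exact hx'.trans h1
    _ = ∑ i, m * (ρ.prod ρ).real {p | p.1 i ≠ p.2 i} := Finset.mul_sum _ _ _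
    _ ≤ _ := Finset.sum_le_sum fun i _ => hC i m ρ hm hρ hφ

/-- The atom carrying almost all the mass of a convolution root is eventually the origin. -/
lemma eventually_atom_eq_zero (π : Measure (Fin n → ℤ)) [IsProbabilityMeasure π]
    (ρ : ℕ → Measure (Fin n → ℤ)) (hρ : ∀ m, 1 ≤ m → IsProbabilityMeasure (ρ m))
    (hπ : ∀ m, 1 ≤ m → π = (Measure.pi (fun _ : Fin m => ρ m)).map (fun x => ∑ j, x j))
    (x : ℕ → Fin n → ℤ) (C : ℝ) (hx : ∀ m, 1 ≤ m → m * (ρ m).real {x m}ᶜ ≤ C) :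
    ∀ᶠ m in atTop, x m = 0 := by
  set T : ℕ → Set (Fin n → ℤ) := fun m => {k | ∃ i, (m : ℤ) ≤ |k i|} with hT
  have hTanti : Antitone T := fun a b hab k ⟨i, hi⟩ => ⟨i, le_trans (by exact_mod_cast hab) hi⟩
  have hTempty : ⋂ m, T m = ∅ := by
    refine eq_empty_of_forall_notMem fun k hk => ?_
    obtain ⟨i, hi⟩ := mem_iInter.1 hk (∑ i, (k i).natAbs + 1)
    have h1 : (k i).natAbs ≤ ∑ i, (k i).natAbs :=
      Finset.single_le_sum (f := fun i => (k i).natAbs) (fun _ _ => Nat.zero_le _)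
        (Finset.mem_univ i)
    rw [Int.abs_eq_natAbs] at hi
    omega
  have hT0 : Tendsto (fun m => π.real (T m)) atTop (𝓝 0) := by
    have h := tendsto_measure_iInter_atTop (μ := π) (s := T)
      (fun m => MeasurableSet.of_discrete.nullMeasurableSet) hTanti ⟨0, measure_ne_top _ _⟩
    rw [hTempty, measure_empty] at h
    exact (ENNReal.tendsto_toReal ENNReal.zero_ne_top).comp h
  have hexp := Real.tendsto_one_add_div_pow_exp (-C)
  have hpos : 0 < Real.exp (-C) / 2 := by positivity
  have hev1 := hT0.eventually (gt_mem_nhds hpos)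
  have hev2 := hexp.eventually (lt_mem_nhds (half_lt_self (Real.exp_pos (-C))))
  filter_upwards [hev1, hev2, eventually_ge_atTop 1, eventually_ge_atTop ⌈C⌉₊]
    with m h1 h2 hm hmC
  -- If `x m ≠ 0`, all `m` summands equal `x m` with probability at least `(1 - C/m)^m`, which tends
  -- to `e^{-C}`, and the sum `m • x m` then lies in `T m`. This contradicts `π (T m) → 0`.
  by_contra hne
  have := hρ m hm
  have hm' : (0 : ℝ) < m := by exact_mod_cast hm
  have hCm : C ≤ m := (Nat.le_ceil C).trans (by exact_mod_cast hmC)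
  have h3 : 1 + -C / m ≤ (ρ m).real {x m} := by
    have h4 := probReal_compl_eq_one_sub (μ := ρ m) (measurableSet_singleton (x m))
    have h5 := hx m hm
    rw [h4] at h5
    have h6 : 1 - (ρ m).real {x m} ≤ C / m := by rw [le_div_iff₀ hm']; linarith
    rw [neg_div]; linarith
  have h4 : 0 ≤ 1 + -C / m := by
    have : C / m ≤ 1 := (div_le_one hm').2 hCm
    rw [neg_div]; linarith
  have h5 : (ρ m).real {x m} ^ m ≤ π.real (T m) := by
    have h6 : (Measure.pi (fun _ : Fin m => ρ m)).real {fun _ => x m} = (ρ m).real {x m} ^ m := by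
      rw [measureReal_def, Measure.pi_singleton, Finset.prod_const, Finset.card_univ,
        Fintype.card_fin, ENNReal.toReal_pow, measureReal_def]
    rw [← h6]
    conv_rhs => rw [hπ m hm]
    rw [map_measureReal_apply (by fun_prop) MeasurableSet.of_discrete]
    refine measureReal_mono fun y hy => ?_
    obtain ⟨i, hi⟩ := Function.ne_iff.1 hne
    rw [mem_singleton_iff] at hy
    refine ⟨i, ?_⟩
    have h7 := Int.one_le_abs hi
    simp only [hy, Finset.sum_const, Finset.card_univ, Fintype.card_fin, Pi.smul_apply,
      nsmul_eq_mul, abs_mul, Nat.abs_cast]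
    exact le_mul_of_one_le_right (by positivity) h7
  have h6 : (1 + -C / m) ^ m ≤ (ρ m).real {x m} ^ m := pow_le_pow_left₀ h4 h3 m
  linarith

/-- Desymmetrization: an independent copy vanishes with probability at least `1/2`, so each
coordinate tail of `ρ` is at most twice that of the difference. -/
lemma exists_finset_tail_bound {φ : EuclideanSpace ℝ (Fin n) → ℂ} (hc : Continuous φ)
    (h0 : φ 0 = 1) {ε : ℝ} (hε : 0 < ε) :
    ∃ F : Finset (Fin n → ℤ), ∀ (m : ℕ) (ρ : Measure (Fin n → ℤ)), 1 ≤ m →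
      IsProbabilityMeasure ρ → (∀ θ, φ θ = charFun (ρ.map (intVec n)) θ ^ m) →
      1 / 2 ≤ ρ.real {0} → m * ρ.real (F : Set (Fin n → ℤ))ᶜ ≤ ε := by
  -- Each coordinate costs `8δ`: the symmetrized bound `4δ`, doubled. Using `n + 1` keeps the
  -- denominator nonzero when `n = 0`.
  set δ := ε / (8 * (n + 1)) with hδ
  choose R hR _ htail using fun i : Fin n => exists_tail_bound hc h0 i (ε := δ) (by positivity)
  refine ⟨Fintype.piFinset fun i => Finset.Icc (-⌈R i⌉) ⌈R i⌉, fun m ρ hm hρ hφ hhalf => ?_⟩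
  have h1 : ∀ i, m * ρ.real {k | R i < |((k i : ℤ) : ℝ)|} ≤ 8 * δ := by
    intro i
    have h2 : ρ.real {k | R i < |((k i : ℤ) : ℝ)|} * ρ.real {0} ≤
        (ρ.prod ρ).real {p | R i < |((p.1 i - p.2 i : ℤ) : ℝ)|} := by
      rw [← measureReal_prod_prod]
      refine measureReal_mono ?_
      rintro ⟨a, b⟩ ⟨ha, hb⟩
      obtain rfl : b = 0 := hb
      simpa using ha
    have h3 := htail i m ρ hm hρ hφ
    have h4 : ρ.real {k | R i < |((k i : ℤ) : ℝ)|} * (1 / 2) ≤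
        ρ.real {k | R i < |((k i : ℤ) : ℝ)|} * ρ.real {0} := by gcongr
    calc m * ρ.real {k | R i < |((k i : ℤ) : ℝ)|}
        = 2 * (m * (ρ.real {k | R i < |((k i : ℤ) : ℝ)|} * (1 / 2))) := by ring
      _ ≤ 2 * (m * (ρ.prod ρ).real {p | R i < |((p.1 i - p.2 i : ℤ) : ℝ)|}) := by
        gcongr; exact h4.trans h2
      _ ≤ _ := by linarith
  have h2 : ρ.real ((Fintype.piFinset fun i => Finset.Icc (-⌈R i⌉) ⌈R i⌉ :
      Finset (Fin n → ℤ)) : Set (Fin n → ℤ))ᶜ ≤ ∑ i, ρ.real {k | R i < |((k i : ℤ) : ℝ)|} := by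
    refine (measureReal_mono (fun k hk => ?_) (measure_ne_top _ _)).trans
      (measureReal_biUnion_finset_le Finset.univ _)
    simp only [mem_compl_iff, Finset.mem_coe, Fintype.mem_piFinset, Finset.mem_Icc, not_forall,
      ← abs_le] at hk
    obtain ⟨i, hi⟩ := hk
    simp only [mem_iUnion]
    refine ⟨i, Finset.mem_univ _, ?_⟩
    have h3 : ((⌈R i⌉ : ℤ) : ℝ) < ((|k i| : ℤ) : ℝ) := by exact_mod_cast not_le.1 hi
    rw [Int.cast_abs] at h3
    exact (Int.le_ceil _).trans_lt h3
  calc _ ≤ m * ∑ i, ρ.real {k | R i < |((k i : ℤ) : ℝ)|} := by gcongr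
    _ = ∑ i, m * ρ.real {k | R i < |((k i : ℤ) : ℝ)|} := Finset.mul_sum _ _ _
    _ ≤ ∑ _i : Fin n, 8 * δ := Finset.sum_le_sum fun i _ => h1 i
    _ = n * (8 * δ) := by simp
    _ ≤ (n + 1) * (8 * δ) := by gcongr; linarith
    _ = ε := by rw [hδ]; field_simp

/-- Vague compactness with tightness: along some ultrafilter the rescaled measures `m • ρ m`
converge, off the origin, against bounded functions. -/
lemma exists_ultrafilter_limit {κ : Type*} [Countable κ] [Zero κ] [MeasurableSpace κ]
    [MeasurableSingletonClass κ] (ρ : ℕ → Measure κ) (C : ℝ)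
    (hρ : ∀ᶠ m in atTop, IsProbabilityMeasure (ρ m))
    (hC : ∀ᶠ m in atTop, m * (ρ m).real {0}ᶜ ≤ C)
    (ht : ∀ ε : ℝ, 0 < ε → ∃ F : Finset κ, ∀ᶠ m in atTop, m * (ρ m).real (F : Set κ)ᶜ ≤ ε) :
    ∃ (U : Ultrafilter ℕ) (a : κ → ℝ), (U : Filter ℕ) ≤ atTop ∧ 0 ≤ a ∧ a 0 = 0 ∧ Summable a ∧
      ∀ (f : κ → ℂ) (B : ℝ), (∀ k, ‖f k‖ ≤ B) → f 0 = 0 →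
        Tendsto (fun m : ℕ => (m : ℂ) * ∫ k, f k ∂(ρ m)) U (𝓝 (∑' k, a k • f k)) := by
  classical
  have hd : DiscreteMeasurableSpace κ := inferInstance
  -- An ultrafilter yields limits at all points of `κ` simultaneously, with no diagonal extraction.
  set U : Ultrafilter ℕ := hyperfilter ℕ with hUdef
  have hU : (U : Filter ℕ) ≤ atTop := Nat.hyperfilter_le_atTop
  -- The mass at the origin is discarded: `m * ρ m {0}` is unbounded, and test functions vanish
  -- there.
  set A : ℕ → κ → ℝ := fun m k => if k = 0 then 0 else m * (ρ m).real {k} with hA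
  have hA0 : ∀ m k, 0 ≤ A m k := by
    intro m k; simp only [hA]; split_ifs <;> positivity
  have hAsum : ∀ᶠ m in atTop, ∀ F : Finset κ, ∑ k ∈ F, A m k ≤ C := by
    filter_upwards [hρ, hC] with m h1 h2 F
    calc ∑ k ∈ F, A m k = ∑ k ∈ F with k ≠ 0, m * (ρ m).real {k} := by
          rw [Finset.sum_filter]
          exact Finset.sum_congr rfl fun k _ => by by_cases h : k = 0 <;> simp [hA, h]
      _ = m * (ρ m).real ((F.filter (· ≠ 0) : Finset κ) : Set κ) := by
          rw [← Finset.mul_sum, sum_measureReal_singleton]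
      _ ≤ m * (ρ m).real {0}ᶜ := by
          refine mul_le_mul_of_nonneg_left (measureReal_mono (fun k hk => ?_)) (by positivity)
          simpa using (Finset.mem_filter.1 hk).2
      _ ≤ C := h2
  have hlim : ∀ k, ∃ a ∈ Icc 0 C, Tendsto (fun m => A m k) U (𝓝 a) := by
    intro k
    refine isCompact_Icc.ultrafilter_le_nhds (U.map fun m => A m k) ?_
    rw [le_principal_iff]
    have : ∀ᶠ m in (U : Filter ℕ), A m k ∈ Icc 0 C := by
      filter_upwards [hU hAsum] with m hm
      exact ⟨hA0 m k, by simpa using hm {k}⟩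
    exact this
  choose a ha hat using hlim
  have ha0 : 0 ≤ a := fun k => (ha k).1
  have hsumF : ∀ F : Finset κ, ∑ k ∈ F, a k ≤ C := fun F =>
    le_of_tendsto (tendsto_finsetSum F fun k _ => hat k) (Eventually.mono (hU hAsum) fun m hm => hm F)
  have hsum : Summable a := summable_of_sum_le ha0 hsumF
  refine ⟨U, a, hU, ha0, ?_, hsum, fun f B hB hf0 => ?_⟩
  · refine tendsto_nhds_unique (hat 0) ?_
    simp [hA]
  have hB0 : 0 ≤ B := (norm_nonneg _).trans (hB 0)
  have hsf : Summable fun k => a k • f k := by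
    refine Summable.of_norm_bounded (hsum.mul_right B) fun k => ?_
    rw [norm_smul, Real.norm_of_nonneg (ha0 k)]
    exact mul_le_mul_of_nonneg_left (hB k) (ha0 k)
  rw [Metric.tendsto_nhds]
  intro ε hε
  set δ := ε / (3 * (B + 1)) with hδ
  have hδ0 : 0 < δ := by positivity
  have hBδ : B * δ < ε / 3 := by
    calc B * δ < (B + 1) * δ := by gcongr; linarith
      _ = ε / 3 := by rw [hδ]; field_simp
  obtain ⟨F₀, hF₀⟩ := ht δ hδ0
  -- `F₁` serves twice: it makes the tail of the limit series small, and it contains `F₀`, so the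
  -- tail of `m • ρ m` is uniformly small too.
  obtain ⟨F₁, hF₁⟩ := ((Metric.tendsto_nhds.1 hsf.hasSum (ε / 3) (by positivity)).and
    (eventually_ge_atTop F₀)).exists
  have hfin : Tendsto (fun m => ∑ k ∈ F₁, A m k • f k) U (𝓝 (∑ k ∈ F₁, a k • f k)) :=
    tendsto_finsetSum _ fun k _ => (hat k).smul_const _
  filter_upwards [hU hρ, hU hF₀, Metric.tendsto_nhds.1 hfin (ε / 3) (by positivity)]
    with m h1 h2 h3
  have hint : Integrable f (ρ m) :=
    Integrable.of_bound (measurable_of_countable f).aestronglyMeasurable B (ae_of_all _ hB)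
  have h4 : (m : ℂ) * ∫ k, f k ∂(ρ m) =
      ∑ k ∈ F₁, A m k • f k + (m : ℂ) * ∫ k in (F₁ : Set κ)ᶜ, f k ∂(ρ m) := by
    rw [← integral_add_compl (s := (F₁ : Set κ)) MeasurableSet.of_discrete hint, mul_add,
      setIntegral_finset _ hint.integrableOn, Finset.mul_sum]
    congr 1
    refine Finset.sum_congr rfl fun k _ => ?_
    by_cases h : k = 0
    · simp [h, hf0]
    · simp [hA, h, mul_assoc]
  have h5 : ‖(m : ℂ) * ∫ k in (F₁ : Set κ)ᶜ, f k ∂(ρ m)‖ ≤ B * δ := by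
    rw [norm_mul, Complex.norm_natCast]
    have h6 : ‖∫ k in (F₁ : Set κ)ᶜ, f k ∂(ρ m)‖ ≤ B * (ρ m).real (F₁ : Set κ)ᶜ :=
      norm_setIntegral_le_of_norm_le_const (measure_lt_top _ _) fun k _ => hB k
    have h7 : (ρ m).real (F₁ : Set κ)ᶜ ≤ (ρ m).real (F₀ : Set κ)ᶜ :=
      measureReal_mono (compl_subset_compl.2 (by exact_mod_cast hF₁.2))
    calc m * ‖∫ k in (F₁ : Set κ)ᶜ, f k ∂(ρ m)‖ ≤ m * (B * (ρ m).real (F₀ : Set κ)ᶜ) := by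
          gcongr; exact h6.trans (by gcongr)
      _ = B * (m * (ρ m).real (F₀ : Set κ)ᶜ) := by ring
      _ ≤ B * δ := by gcongr
  rw [h4]
  have h6 := dist_triangle (∑ k ∈ F₁, A m k • f k + (m : ℂ) * ∫ k in (F₁ : Set κ)ᶜ, f k ∂(ρ m))
    (∑ k ∈ F₁, A m k • f k) (∑' k, a k • f k)
  have h7 := dist_triangle (∑ k ∈ F₁, A m k • f k) (∑ k ∈ F₁, a k • f k) (∑' k, a k • f k)
  rw [dist_self_add_left] at h6
  linarith [hF₁.1]

lemma norm_pow_sub_pow_le {a b : ℂ} (ha : ‖a‖ ≤ 1) (hb : ‖b‖ ≤ 1) (m : ℕ) :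
    ‖a ^ m - b ^ m‖ ≤ m * ‖a - b‖ := by
  induction m with
  | zero => simp
  | succ m ih =>
    calc ‖a ^ (m + 1) - b ^ (m + 1)‖ = ‖a ^ m * (a - b) + (a ^ m - b ^ m) * b‖ := by ring_nf
      _ ≤ ‖a ^ m‖ * ‖a - b‖ + ‖a ^ m - b ^ m‖ * ‖b‖ := by
        rw [← norm_mul, ← norm_mul]; exact norm_add_le _ _
      _ ≤ 1 * ‖a - b‖ + (m * ‖a - b‖) * 1 := by
        gcongr
        rw [norm_pow]; exact pow_le_one₀ (norm_nonneg _) ha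
      _ = _ := by push_cast; ring

/-- `(1 + z/m) ^ m` is close to `exp z` for bounded `z`. -/
lemma norm_pow_sub_exp_le {a z : ℂ} {K : ℝ} {m : ℕ} (hm : 1 ≤ m) (ha : ‖a‖ ≤ 1)
    (hz : z = m * (a - 1)) (hK : ‖z‖ ≤ K) (hKm : K ≤ m) :
    ‖a ^ m - Complex.exp z‖ ≤ K ^ 2 / m := by
  have hm' : (0 : ℝ) < m := by exact_mod_cast hm
  -- Both terms are `m`-th powers of points of the closed unit disc, so the error is at most `m`
  -- times `‖a - exp (a - 1)‖`. That is quadratic in `a - 1`, since `K ≤ m` forces `‖a - 1‖ ≤ 1`.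
  have hz' : Complex.exp z = Complex.exp (a - 1) ^ m := by rw [hz, Complex.exp_nat_mul]
  have hn : ‖a - 1‖ ≤ K / m := by
    rw [hz, norm_mul, Complex.norm_natCast] at hK
    rw [le_div_iff₀ hm']; linarith
  have hb : ‖Complex.exp (a - 1)‖ ≤ 1 := by
    rw [Complex.norm_exp, Real.exp_le_one_iff]
    have := (Complex.re_le_norm a).trans ha
    simpa using this
  have h1 : ‖a - Complex.exp (a - 1)‖ ≤ (K / m) ^ 2 := by
    have h2 := Complex.norm_exp_sub_one_sub_id_le (x := a - 1)
      (hn.trans ((div_le_one hm').2 hKm))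
    rw [norm_sub_rev]
    calc ‖Complex.exp (a - 1) - a‖ = ‖Complex.exp (a - 1) - 1 - (a - 1)‖ := by congr 1; ring
      _ ≤ ‖a - 1‖ ^ 2 := h2
      _ ≤ _ := by gcongr
  rw [hz']
  calc _ ≤ m * ‖a - Complex.exp (a - 1)‖ := norm_pow_sub_pow_le ha hb m
    _ ≤ m * (K / m) ^ 2 := by gcongr
    _ = K ^ 2 / m := by field_simp

/-- An infinitely divisible law on `ℤⁿ` is compound Poisson. -/
theorem IsInfinitelyDivisibleInt.exists_compoundPoisson {π : Measure (Fin n → ℤ)}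
    [IsProbabilityMeasure π] (hID : IsInfinitelyDivisibleInt π) :
    ∃ η : Measure (Fin n → ℤ), IsFiniteMeasure η ∧ η {0} = 0 ∧ ∀ θ,
      charFun (π.map (intVec n)) θ = Complex.exp
        (∫ k, (Complex.exp (Complex.I * ((inner ℝ θ (intVec n k) : ℝ) : ℂ)) - 1) ∂η) := by
  classical
  have hmi := measurable_intVec n
  have : IsProbabilityMeasure (π.map (intVec n)) := Measure.isProbabilityMeasure_map hmi.aemeasurable
  choose! ρ hρ hπ using hID
  set φ := charFun (π.map (intVec n)) with hφdef
  have hc : Continuous φ := continuous_charFun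
  have h0 : φ 0 = 1 := by simp [hφdef, charFun_zero]
  have hφ : ∀ m, 1 ≤ m → ∀ θ, φ θ = charFun ((ρ m).map (intVec n)) θ ^ m := by
    intro m hm θ
    have := hρ m hm
    rw [hφdef, ← charFun_map_intVec_sum, ← hπ m hm]
  obtain ⟨C, hC0, hC⟩ := exists_singleton_compl_bound hc h0
  choose! x hx using fun m (hm : 1 ≤ m) => hC m (ρ m) hm (hρ m hm) (hφ m hm)
  have hx0 := eventually_atom_eq_zero π ρ hρ hπ x C hx
  have hC' : ∀ᶠ m in atTop, m * (ρ m).real {0}ᶜ ≤ C := by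
    filter_upwards [hx0, eventually_ge_atTop 1] with m h1 hm
    rw [← h1]; exact hx m hm
  have hρ' : ∀ᶠ m in atTop, IsProbabilityMeasure (ρ m) := by
    filter_upwards [eventually_ge_atTop 1] with m hm using hρ m hm
  have hhalf : ∀ᶠ m in atTop, 1 / 2 ≤ (ρ m).real {0} := by
    filter_upwards [hC', eventually_ge_atTop 1, eventually_ge_atTop ⌈2 * C⌉₊] with m h1 hm hmC
    have := hρ m hm
    have hm' : (0 : ℝ) < m := by exact_mod_cast hm
    have h2 : 2 * C ≤ m := (Nat.le_ceil _).trans (by exact_mod_cast hmC)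
    rw [probReal_compl_eq_one_sub (measurableSet_singleton _)] at h1
    by_contra! h3
    nlinarith
  have htight : ∀ ε : ℝ, 0 < ε → ∃ F : Finset (Fin n → ℤ),
      ∀ᶠ m in atTop, m * (ρ m).real (F : Set (Fin n → ℤ))ᶜ ≤ ε := by
    intro ε hε
    obtain ⟨F, hF⟩ := exists_finset_tail_bound hc h0 hε
    refine ⟨F, ?_⟩
    filter_upwards [hhalf, eventually_ge_atTop 1] with m h1 hm
    exact hF m (ρ m) hm (hρ m hm) (hφ m hm) h1
  obtain ⟨U, a, hU, ha0, haz, hasum, hlim⟩ := exists_ultrafilter_limit ρ C hρ' hC' htight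
  refine ⟨Measure.sum fun k => ENNReal.ofReal (a k) • Measure.dirac k, ⟨?_⟩, ?_, fun θ => ?_⟩
  · rw [Measure.sum_apply _ MeasurableSet.univ]
    simp only [Measure.smul_apply, measure_univ, smul_eq_mul, mul_one]
    rw [← ENNReal.ofReal_tsum_of_nonneg ha0 hasum]
    exact ENNReal.ofReal_lt_top
  · rw [Measure.sum_smul_dirac_singleton, haz, ENNReal.ofReal_zero]
  set f : (Fin n → ℤ) → ℂ :=
    fun k => Complex.exp (Complex.I * ((inner ℝ θ (intVec n k) : ℝ) : ℂ)) - 1 with hf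
  have hfB : ∀ k, ‖f k‖ ≤ 2 := by
    intro k
    refine (norm_sub_le _ _).trans ?_
    rw [mul_comm, Complex.norm_exp_ofReal_mul_I]
    norm_num
  have hiv0 : intVec n 0 = 0 := by ext i; simp [intVec]
  have hf0 : f 0 = 0 := by simp [hf, hiv0]
  have h1 := hlim f 2 hfB hf0
  rw [integral_sum_dirac (by simp)]
  simp only [ENNReal.toReal_ofReal (ha0 _)]
  have h2 : Tendsto (fun m : ℕ => Complex.exp ((m : ℂ) * ∫ k, f k ∂(ρ m))) U
      (𝓝 (Complex.exp (∑' k, a k • f k))) := (Complex.continuous_exp.tendsto _).comp h1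
  refine tendsto_nhds_unique ?_ h2
  rw [tendsto_iff_norm_sub_tendsto_zero]
  -- Along `U` the constant `φ θ` is compared with `exp (m ∫ f dρ m)`. The bound `2 * C` on the
  -- exponent comes from `‖f‖ ≤ 2`, `f 0 = 0` and `m * ρ m {0}ᶜ ≤ C`.
  have h3 : Tendsto (fun m : ℕ => (2 * C) ^ 2 / (m : ℝ)) U (𝓝 0) :=
    (tendsto_const_div_atTop_nhds_zero_nat _).mono_left hU
  refine squeeze_zero' (Eventually.of_forall fun _ => norm_nonneg _) ?_ h3
  refine hU ?_
  filter_upwards [hC', eventually_ge_atTop 1, eventually_ge_atTop ⌈2 * C⌉₊] with m h4 hm hmC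
  have := hρ m hm
  have : IsProbabilityMeasure ((ρ m).map (intVec n)) :=
    Measure.isProbabilityMeasure_map hmi.aemeasurable
  have h5 : ∫ k, f k ∂(ρ m) = charFun ((ρ m).map (intVec n)) θ - 1 := by
    rw [charFun_map_intVec, hf, integral_sub _ (integrable_const _)]
    · simp
    · refine Integrable.of_bound (measurable_of_countable _).aestronglyMeasurable 1
        (ae_of_all _ fun k => ?_)
      rw [mul_comm, Complex.norm_exp_ofReal_mul_I]
  have h6 : ‖∫ k, f k ∂(ρ m)‖ ≤ 2 * (ρ m).real {0}ᶜ := by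
    have h7 : ∫ k, f k ∂(ρ m) = ∫ k in {0}ᶜ, f k ∂(ρ m) := by
      refine (setIntegral_eq_integral_of_forall_compl_eq_zero fun k hk => ?_).symm
      simp only [mem_compl_iff, mem_singleton_iff, not_not] at hk
      rw [hk, hf0]
    rw [h7]
    exact norm_setIntegral_le_of_norm_le_const (measure_lt_top _ _) fun k _ => hfB k
  rw [norm_sub_rev, hφ m hm]
  refine norm_pow_sub_exp_le hm (norm_charFun_le_one _) (congrArg _ h5) ?_
    ((Nat.le_ceil _).trans (by exact_mod_cast hmC))
  rw [norm_mul, Complex.norm_natCast]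
  calc m * ‖∫ k, f k ∂(ρ m)‖ ≤ m * (2 * (ρ m).real {0}ᶜ) := by gcongr
    _ = 2 * (m * (ρ m).real {0}ᶜ) := by ring
    _ ≤ 2 * C := by gcongr

end LevyKhintchine

/-! ### Poisson samples of independent points, and limits of counts -/

section PoissonRandomMeasure

open Filter Topology

variable {E : Type*} [MeasurableSpace E]

lemma integral_infinitePi_prod_range {X : ℕ → Type*} [∀ j, MeasurableSpace (X j)]
    (P : ∀ j, Measure (X j)) [∀ j, IsProbabilityMeasure (P j)] {h : ∀ j, X j → ℂ}
    (hh : ∀ j, Measurable (h j)) (J : ℕ) :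
    ∫ ω, ∏ j ∈ Finset.range J, h j (ω j) ∂(Measure.infinitePi P) =
      ∏ j ∈ Finset.range J, ∫ x, h j x ∂(P j) := by
  have hind : iIndepFun (fun (j : Fin J) (ω : ∀ j, X j) => h j (ω j)) (Measure.infinitePi P) :=
    (iIndepFun_infinitePi (P := P) hh).precomp Fin.val_injective
  simp_rw [Finset.prod_range]
  rw [hind.integral_fun_prod_eq_prod_integral fun j => by
    have := hh j; exact Measurable.aestronglyMeasurable (by fun_prop)]
  refine Finset.prod_congr rfl fun j _ => ?_
  rw [← Measure.infinitePi_map_eval P j, integral_map (measurable_pi_apply _).aemeasurable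
    (hh j).aestronglyMeasurable]

/-- The number of points among the first `w.1` terms of the sequence `w.2` that lie in `B`. -/
noncomputable def pointCount (w : ℕ × (ℕ → E)) (B : Set E) : ℕ :=
  ∑ i ∈ Finset.range w.1, B.indicator (fun _ => 1) (w.2 i)

lemma measurable_pointCount {B : Set E} (hB : MeasurableSet B) :
    Measurable (fun w : ℕ × (ℕ → E) => pointCount w B) := by
  refine measurable_from_prod_countable_right fun k => ?_
  change Measurable fun y : ℕ → E => ∑ i ∈ Finset.range k, B.indicator (fun _ => 1) (y i)
  refine Finset.measurable_sum _ fun i _ => ?_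
  exact (measurable_const.indicator hB).comp (measurable_pi_apply i)

/-- A Poisson number of independent points with law `p`. -/
noncomputable def poissonSampleLaw (r : ℝ≥0) (p : Measure E) : Measure (ℕ × (ℕ → E)) :=
  (poissonMeasure r).prod (Measure.infinitePi fun _ => p)

instance (r : ℝ≥0) (p : Measure E) [IsProbabilityMeasure p] :
    IsProbabilityMeasure (poissonSampleLaw r p) := by
  unfold poissonSampleLaw; infer_instance

/-- Given `k` points, independence gives `q ^ k` with `q = ∫ h dp`; averaging over `k` is the
Poisson generating function at `q`. -/
lemma integral_prod_poissonSampleLaw (r : ℝ≥0) (p : Measure E) [IsProbabilityMeasure p] {h : E → ℂ}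
    (hh : Measurable h) (hb : ∀ x, ‖h x‖ ≤ 1) :
    ∫ w, ∏ i ∈ Finset.range w.1, h (w.2 i) ∂(poissonSampleLaw r p) =
      Complex.exp (r * (∫ x, h x ∂p - 1)) := by
  have hm : Measurable fun w : ℕ × (ℕ → E) => ∏ i ∈ Finset.range w.1, h (w.2 i) := by
    refine measurable_from_prod_countable_right fun k => ?_
    change Measurable fun y : ℕ → E => ∏ i ∈ Finset.range k, h (y i)
    exact Finset.measurable_prod _ fun i _ => hh.comp (measurable_pi_apply i)
  have hint : Integrable (fun w : ℕ × (ℕ → E) => ∏ i ∈ Finset.range w.1, h (w.2 i))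
      ((poissonMeasure r).prod (Measure.infinitePi fun _ => p)) := by
    refine Integrable.of_bound hm.aestronglyMeasurable 1 (ae_of_all _ fun w => ?_)
    rw [norm_prod]
    exact Finset.prod_le_one (fun _ _ => norm_nonneg _) fun i _ => hb _
  rw [poissonSampleLaw, integral_prod _ hint]
  set q := ∫ x, h x ∂p
  have h1 : ∀ k : ℕ, ∫ x : ℕ → E, ∏ i ∈ Finset.range k, h (x i)
      ∂(Measure.infinitePi fun _ => p) = q ^ k := fun k => by
    rw [integral_infinitePi_prod_range (fun _ => p) (fun _ => hh)]; simp [q]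
  simp only [h1]
  rw [integral_poissonMeasure]
  have h2 := (NormedSpace.expSeries_div_hasSum_exp (r * q : ℂ)).mul_left (Complex.exp (-r))
  rw [← Complex.exp_eq_exp_ℂ, ← Complex.exp_add] at h2
  rw [mul_sub, mul_one, sub_eq_neg_add, ← h2.tsum_eq]
  refine tsum_congr fun k => ?_
  rw [Complex.real_smul]
  push_cast
  rw [mul_pow]
  ring

/-- The exponential is a product over sample points. As the sets are disjoint, each point lies in at
most one of them, so its factor is linear in the indicators. -/
lemma integral_exp_pointCount {ι : Type*} [Fintype ι] (r : ℝ≥0) (p : Measure E)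
    [IsProbabilityMeasure p] {B : ι → Set E} (hB : ∀ l, MeasurableSet (B l))
    (hd : Pairwise (Disjoint on B)) (θ : ι → ℝ) :
    ∫ w, Complex.exp ((∑ l, θ l * pointCount w (B l) : ℝ) * Complex.I) ∂(poissonSampleLaw r p) =
      Complex.exp (∑ l, (r * p.real (B l) : ℝ) * (Complex.exp (θ l * Complex.I) - 1)) := by
  classical
  set h : E → ℂ := fun x => Complex.exp ((∑ l, θ l * (B l).indicator (fun _ => 1) x : ℝ) * Complex.I)
    with hh
  have hhm : Measurable h := by
    have : Measurable fun x => ∑ l, θ l * (B l).indicator (fun _ => (1 : ℝ)) x :=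
      Finset.measurable_sum _ fun l _ => (measurable_const.indicator (hB l)).const_mul _
    fun_prop
  have h1 : ∀ w : ℕ × (ℕ → E), Complex.exp ((∑ l, θ l * pointCount w (B l) : ℝ) * Complex.I) =
      ∏ i ∈ Finset.range w.1, h (w.2 i) := by
    intro w
    rw [hh, ← Complex.exp_sum, ← Finset.sum_mul, ← Complex.ofReal_sum, Finset.sum_comm]
    congr 3
    refine Finset.sum_congr rfl fun l _ => ?_
    rw [pointCount, Nat.cast_sum, Finset.mul_sum]
    refine Finset.sum_congr rfl fun i _ => ?_
    by_cases hx : w.2 i ∈ B l <;> simp [hx]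
  have h2 : ∀ x, h x = 1 + ∑ l, (B l).indicator (fun _ => Complex.exp (θ l * Complex.I) - 1) x := by
    intro x
    by_cases hx : ∃ l, x ∈ B l
    · obtain ⟨l, hl⟩ := hx
      have hne : ∀ l', l' ≠ l → x ∉ B l' := fun l' hl' hx' =>
        Set.disjoint_left.1 (hd hl') hx' hl
      rw [Finset.sum_eq_single l (fun l' _ hl' => indicator_of_notMem (hne l' hl') _) (by simp), hh]
      simp only
      rw [Finset.sum_eq_single l (fun l' _ hl' => by simp [hne l' hl']) (by simp)]
      simp [hl]
    · push Not at hx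
      simp [hh, hx]
  have hint : ∀ l, Integrable ((B l).indicator fun _ => Complex.exp (θ l * Complex.I) - 1) p :=
    fun l => (integrable_const _).indicator (hB l)
  simp_rw [h1]
  rw [integral_prod_poissonSampleLaw r p hhm fun x => by rw [hh, Complex.norm_exp_ofReal_mul_I]]
  congr 1
  simp_rw [h2]
  rw [integral_add (integrable_const _) (integrable_finsetSum _ fun l _ => hint l),
    integral_finsetSum _ fun l _ => hint l]
  simp only [integral_const, probReal_univ, one_smul, add_sub_cancel_left, Finset.mul_sum]
  refine Finset.sum_congr rfl fun l _ => ?_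
  rw [integral_indicator (hB l), setIntegral_const, Complex.real_smul]
  push_cast
  ring

/-- A supremum is at most `a` exactly when every term is, so probabilities of intersections of such
events are limits from above. The product formula passes to the limit on the π-system of half-lines
`Iic a`, which generates. -/
lemma iIndepFun_iSup {Ω ι : Type*} [MeasurableSpace Ω] {P : Measure Ω} [IsProbabilityMeasure P]
    {M : ℕ → ι → Ω → ℝ≥0∞} (hM : ∀ J i, Measurable (M J i)) (hmono : ∀ i ω, Monotone fun J => M J i ω)
    (hind : ∀ J, iIndepFun (M J) P) : iIndepFun (fun i ω => ⨆ J, M J i ω) P := by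
  have hsup : ∀ i, Measurable fun ω => ⨆ J, M J i ω := fun i => .iSup fun J => hM J i
  have key : ∀ (S : Finset ι) (a : ι → ℝ≥0∞),
      Tendsto (fun J => P (⋂ i ∈ S, M J i ⁻¹' Iic (a i))) atTop
        (𝓝 (P (⋂ i ∈ S, (fun ω => ⨆ J, M J i ω) ⁻¹' Iic (a i)))) := by
    intro S a
    have h1 : (⋂ i ∈ S, (fun ω => ⨆ J, M J i ω) ⁻¹' Iic (a i)) =
        ⋂ J, ⋂ i ∈ S, M J i ⁻¹' Iic (a i) := by
      ext ω
      simp only [mem_iInter, mem_preimage, mem_Iic, iSup_le_iff]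
      tauto
    rw [h1]
    refine tendsto_measure_iInter_atTop (fun J => ?_) (fun J K hJK => ?_) ⟨0, measure_ne_top _ _⟩
    · exact (Finset.measurableSet_biInter _ fun i _ => hM J i measurableSet_Iic).nullMeasurableSet
    · exact iInter₂_mono fun i _ ω hω => (hmono i ω hJK).trans hω
  refine iIndepSets.iIndep (fun i => (hsup i).comap_le)
    (fun i => (preimage fun ω => ⨆ J, M J i ω) '' range Iic) (fun i => ?_) (fun i => ?_) ?_
  · exact isPiSystem_Iic.comap _
  · rw [← MeasurableSpace.comap_generateFrom, ← borel_eq_generateFrom_Iic, ← BorelSpace.measurable_eq]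
  · rw [iIndepSets_iff]
    intro S f hf
    have hf' : ∀ i, ∃ a, i ∈ S → f i = (fun ω => ⨆ J, M J i ω) ⁻¹' Iic a := by
      intro i
      by_cases hi : i ∈ S
      · obtain ⟨_, ⟨a, rfl⟩, h⟩ := hf i hi
        exact ⟨a, fun _ => h.symm⟩
      · exact ⟨0, fun h => absurd h hi⟩
    choose a ha using hf'
    have h1 : (⋂ i ∈ S, f i) = ⋂ i ∈ S, (fun ω => ⨆ J, M J i ω) ⁻¹' Iic (a i) :=
      iInter₂_congr ha
    rw [h1, Finset.prod_congr rfl fun i hi => by rw [ha i hi]]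
    refine tendsto_nhds_unique (key S a) ?_
    have h2 : ∀ J, P (⋂ i ∈ S, M J i ⁻¹' Iic (a i)) = ∏ i ∈ S, P (M J i ⁻¹' Iic (a i)) :=
      fun J => (hind J).measure_inter_preimage_eq_mul S fun _ _ => measurableSet_Iic
    simp_rw [h2]
    refine ENNReal.tendsto_finsetProd_of_ne_top _ (fun i _ => ?_) fun i _ => measure_ne_top _ _
    simpa using key {i} a

/-- Below a finite level only finitely many integers occur, so this lemma and the next give the
limiting distribution functions of Poisson counts whose means converge to a finite limit or to
infinity. -/
lemma poissonMeasure_continuous_finset (F : Finset ℕ) :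
    Continuous fun r : ℝ≥0 => poissonMeasure r (F : Set ℕ) := by
  simp_rw [← sum_measure_singleton, poissonMeasure_singleton]
  exact continuous_finsetSum _ fun k _ => ENNReal.continuous_ofReal.comp (by fun_prop)

lemma tendsto_poissonMeasure_finset_atTop (F : Finset ℕ) :
    Tendsto (fun r : ℝ≥0 => poissonMeasure r (F : Set ℕ)) atTop (𝓝 0) := by
  simp_rw [← sum_measure_singleton, poissonMeasure_singleton]
  rw [← Finset.sum_const_zero (s := F)]
  refine tendsto_finsetSum _ fun k _ => ?_
  rw [← ENNReal.ofReal_zero]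
  refine ENNReal.tendsto_ofReal ?_
  have h := ((Real.tendsto_pow_mul_exp_neg_atTop_nhds_zero k).div_const (k.factorial : ℝ)).comp
    (NNReal.tendsto_coe_atTop.2 tendsto_id)
  rw [zero_div] at h
  refine h.congr fun r => ?_
  simp [mul_comm]

end PoissonRandomMeasure

/-! ### Construction of Poisson random measures by superposition -/

section PoissonRandomMeasure

open Filter Topology

universe u

variable {E : Type u} [MeasurableSpace E]

/-- The number of points in `B` of the first `J` independent Poisson samples. -/
noncomputable def partialCount (J : ℕ) (B : Set E) (ω : ℕ → ℕ × (ℕ → E)) : ℕ :=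
  ∑ j ∈ Finset.range J, pointCount (ω j) B

lemma measurable_partialCount (J : ℕ) {B : Set E} (hB : MeasurableSet B) :
    Measurable (partialCount J B) :=
  Finset.measurable_fun_sum _ fun j _ => (measurable_pointCount hB).comp (measurable_pi_apply j)

/-- The point measure carried by a sequence of samples. -/
noncomputable def pointMeasure (ω : ℕ → ℕ × (ℕ → E)) : Measure E :=
  ((Measure.count : Measure (ℕ × ℕ)).restrict {q | q.2 < (ω q.1).1}).map fun q => (ω q.1).2 q.2

lemma pointMeasure_apply (ω : ℕ → ℕ × (ℕ → E)) {B : Set E} (hB : MeasurableSet B) :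
    pointMeasure ω B = ⨆ J, (partialCount J B ω : ℝ≥0∞) := by
  have hm : Measurable fun q : ℕ × ℕ => (ω q.1).2 q.2 := measurable_of_countable _
  rw [pointMeasure, Measure.map_apply hm hB, ← lintegral_indicator_one (hm hB),
    ← lintegral_indicator MeasurableSet.of_discrete, lintegral_count]
  have h1 : ∀ j, ∑' i, {q : ℕ × ℕ | q.2 < (ω q.1).1}.indicator
      (((fun q : ℕ × ℕ => (ω q.1).2 q.2) ⁻¹' B).indicator (1 : ℕ × ℕ → ℝ≥0∞)) (j, i) =
      (pointCount (ω j) B : ℝ≥0∞) := by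
    intro j
    rw [tsum_eq_sum (s := Finset.range (ω j).1) fun i hi => by
      rw [indicator_of_notMem]; simpa using hi]
    rw [pointCount, Nat.cast_sum]
    refine Finset.sum_congr rfl fun i hi => ?_
    rw [indicator_of_mem (by simpa using hi)]
    by_cases h : (ω j).2 i ∈ B <;> simp [h]
  refine (ENNReal.tsum_prod (f := fun j i => {q : ℕ × ℕ | q.2 < (ω q.1).1}.indicator
      (((fun q : ℕ × ℕ => (ω q.1).2 q.2) ⁻¹' B).indicator (1 : ℕ × ℕ → ℝ≥0∞)) (j, i))).trans ?_
  simp_rw [h1, ENNReal.tsum_eq_iSup_nat, partialCount, Nat.cast_sum]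

lemma monotone_partialCount {E : Type*} (B : Set E) (ω : ℕ → ℕ × (ℕ → E)) :
    Monotone fun J => (partialCount J B ω : ℝ≥0∞) := fun _ _ h =>
  Nat.cast_le.2 (Finset.sum_le_sum_of_subset (Finset.range_mono h))

variable (r : ℕ → ℝ≥0) (p : ℕ → Measure E) [∀ j, IsProbabilityMeasure (p j)]

/-- Exponents of independent samples add. The result is a product over `l` of Poisson characteristic
functions: one set yields the law of the count, several yield independence. -/
lemma integral_exp_partialCount {ι : Type*} [Fintype ι] (J : ℕ) {B : ι → Set E}
    (hB : ∀ l, MeasurableSet (B l)) (hd : Pairwise (Disjoint on B)) (θ : ι → ℝ) :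
    ∫ ω, Complex.exp ((∑ l, θ l * partialCount J (B l) ω : ℝ) * Complex.I)
        ∂(Measure.infinitePi fun j => poissonSampleLaw (r j) (p j)) =
      ∏ l, Complex.exp (((∑ j ∈ Finset.range J, r j * (p j (B l)).toNNReal : ℝ≥0) : ℂ) *
        (Complex.exp (θ l * Complex.I) - 1)) := by
  have h1 : ∀ ω : ℕ → ℕ × (ℕ → E),
      Complex.exp ((∑ l, θ l * partialCount J (B l) ω : ℝ) * Complex.I) =
      ∏ j ∈ Finset.range J,
        Complex.exp ((∑ l, θ l * pointCount (ω j) (B l) : ℝ) * Complex.I) := by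
    intro ω
    rw [← Complex.exp_sum, ← Finset.sum_mul, ← Complex.ofReal_sum, Finset.sum_comm]
    congr 3
    refine Finset.sum_congr rfl fun l _ => ?_
    rw [partialCount, Nat.cast_sum, Finset.mul_sum]
  have hm : Measurable fun w : ℕ × (ℕ → E) =>
      Complex.exp ((∑ l, θ l * pointCount w (B l) : ℝ) * Complex.I) := by
    have : ∀ l, Measurable fun w : ℕ × (ℕ → E) => pointCount w (B l) :=
      fun l => measurable_pointCount (hB l)
    fun_prop
  simp_rw [h1]
  rw [integral_infinitePi_prod_range (fun j => poissonSampleLaw (r j) (p j)) (fun _ => hm)]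
  simp_rw [integral_exp_pointCount _ _ hB hd]
  rw [← Complex.exp_sum, ← Complex.exp_sum, Finset.sum_comm]
  congr 1
  refine Finset.sum_congr rfl fun l _ => ?_
  rw [← Finset.sum_mul]
  congr 1
  push_cast
  refine Finset.sum_congr rfl fun j _ => ?_
  rfl

lemma map_partialCount_real (J : ℕ) {B : Set E} (hB : MeasurableSet B) :
    (Measure.infinitePi fun j => poissonSampleLaw (r j) (p j)).map
        (fun ω => (partialCount J B ω : ℝ)) =
      (poissonMeasure (∑ j ∈ Finset.range J, r j * (p j B).toNNReal)).map (Nat.cast : ℕ → ℝ) := by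
  have hm := measurable_partialCount J hB
  have : IsProbabilityMeasure ((Measure.infinitePi fun j => poissonSampleLaw (r j) (p j)).map
        (fun ω => (partialCount J B ω : ℝ))) := Measure.isProbabilityMeasure_map (by fun_prop)
  refine Measure.ext_of_charFun (funext fun t => ?_)
  rw [charFun_map_cast_poissonMeasure, charFun_apply_real, integral_map (by fun_prop) (by fun_prop)]
  have h := integral_exp_partialCount r p J (ι := Unit) (B := fun _ => B) (fun _ => hB)
    (fun a b hab => absurd (Subsingleton.elim a b) hab) (fun _ => t)
  simpa using h

lemma map_partialCount (J : ℕ) {B : Set E} (hB : MeasurableSet B) :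
    (Measure.infinitePi fun j => poissonSampleLaw (r j) (p j)).map
        (fun ω => (partialCount J B ω : ℝ≥0∞)) =
      (poissonMeasure (∑ j ∈ Finset.range J, r j * (p j B).toNNReal)).map
        (fun k : ℕ => (k : ℝ≥0∞)) := by
  have hm := measurable_partialCount J hB
  have h := congrArg (Measure.map ENNReal.ofReal) (map_partialCount_real r p J hB)
  rw [Measure.map_map (by fun_prop) (by fun_prop), Measure.map_map (by fun_prop) (by fun_prop)] at h
  simpa [Function.comp_def] using h

lemma iIndepFun_partialCount {ι : Type*} [Fintype ι] (J : ℕ) {B : ι → Set E}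
    (hB : ∀ l, MeasurableSet (B l)) (hd : Pairwise (Disjoint on B)) :
    iIndepFun (fun l ω => (partialCount J (B l) ω : ℝ≥0∞))
      (Measure.infinitePi fun j => poissonSampleLaw (r j) (p j)) := by
  have hm := fun l => measurable_partialCount J (hB l)
  have h : iIndepFun (fun l ω => (partialCount J (B l) ω : ℝ))
      (Measure.infinitePi fun j => poissonSampleLaw (r j) (p j)) := by
    rw [iIndepFun_iff_charFun_pi fun l => by fun_prop]
    intro t
    simp_rw [map_partialCount_real r p J (hB _), charFun_map_cast_poissonMeasure]
    rw [charFun_apply, integral_map (Measurable.aemeasurable (by fun_prop)) (by fun_prop),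
      ← integral_exp_partialCount r p J hB hd]
    refine integral_congr_ae (ae_of_all _ fun ω => ?_)
    simp [PiLp.inner_apply]
  have h2 := h.comp (fun _ => ENNReal.ofReal) (fun _ => ENNReal.measurable_ofReal)
  simpa [Function.comp_def] using h2

/-- Superposition of independent Poisson samples is a Poisson random measure. -/
theorem isPoissonRandomMeasure_pointMeasure {μ : Measure E}
    (hμ : μ = Measure.sum fun j => r j • p j) :
    IsPoissonRandomMeasure μ pointMeasure
      (Measure.infinitePi fun j => poissonSampleLaw (r j) (p j)) := by
  set P := Measure.infinitePi fun j => poissonSampleLaw (r j) (p j) with hP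
  have hmeas : ∀ B, MeasurableSet B → Measurable fun ω => pointMeasure (E := E) ω B := by
    intro B hB
    have hm := fun J => measurable_partialCount J hB
    simp_rw [pointMeasure_apply _ hB]
    exact .iSup fun J => by fun_prop
  set s : ℕ → Set E → ℝ≥0 := fun J B => ∑ j ∈ Finset.range J, r j * (p j B).toNNReal with hs
  have hsmono : ∀ B, Monotone fun J => s J B := fun B _ _ h =>
    Finset.sum_le_sum_of_subset (Finset.range_mono h)
  have hμB : ∀ B, MeasurableSet B → Tendsto (fun J => (s J B : ℝ≥0∞)) atTop (𝓝 (μ B)) := by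
    intro B hB
    rw [hμ, Measure.sum_apply _ hB]
    convert ENNReal.tendsto_nat_tsum fun j => (r j • p j) B using 2 with J
    rw [hs, ENNReal.ofNNReal_finsetSum]
    refine Finset.sum_congr rfl fun j _ => ?_
    rw [ENNReal.coe_mul, ENNReal.coe_toNNReal (measure_ne_top _ _)]
    rfl
  -- Counts increase with `J`, so `N(B) ≤ a` is a decreasing intersection and distribution functions
  -- converge. This one limit yields both the finite and the infinite intensity case.
  have hcdf : ∀ B, MeasurableSet B → ∀ a : ℝ≥0∞,
      Tendsto (fun J => poissonMeasure (s J B) {k | (k : ℝ≥0∞) ≤ a}) atTop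
        (𝓝 (P {ω | pointMeasure ω B ≤ a})) := by
    intro B hB a
    have hm := fun J => measurable_partialCount J hB
    have h1 : ∀ J, poissonMeasure (s J B) {k | (k : ℝ≥0∞) ≤ a} =
        P {ω | (partialCount J B ω : ℝ≥0∞) ≤ a} := by
      intro J
      have h := congrArg (fun m => m (Iic a)) (map_partialCount r p J hB)
      rw [Measure.map_apply (by fun_prop) measurableSet_Iic,
        Measure.map_apply (by fun_prop) measurableSet_Iic] at h
      exact h.symm
    simp_rw [h1]
    have h2 : {ω | pointMeasure ω B ≤ a} = ⋂ J, {ω | (partialCount J B ω : ℝ≥0∞) ≤ a} := by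
      ext ω
      simp [pointMeasure_apply ω hB]
    rw [h2]
    refine tendsto_measure_iInter_atTop (fun J => ?_) (fun J K hJK ω hω => ?_)
      ⟨0, measure_ne_top _ _⟩
    · exact (measurableSet_le (by fun_prop) measurable_const).nullMeasurableSet
    · exact (monotone_partialCount B ω hJK).trans hω
  have hfin : ∀ a : ℝ≥0∞, a ≠ ∞ → ∃ F : Finset ℕ, {k : ℕ | (k : ℝ≥0∞) ≤ a} = F := by
    intro a ha
    refine ⟨Finset.range (⌊a.toReal⌋₊ + 1), ?_⟩
    ext k
    lift a to ℝ≥0 using ha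
    simp only [mem_ofPred_eq, Finset.coe_range, mem_Iio, ENNReal.coe_toReal, Nat.lt_succ_iff]
    rw [Nat.le_floor_iff a.coe_nonneg]
    exact_mod_cast Iff.rfl
  refine ⟨hmeas, fun ω B hB => ?_, fun B hB hlt => ?_, fun B hB htop => ?_, fun k B hB hd => ?_⟩
  · refine ⟨⨆ J, (partialCount J B ω : ℕ∞), ?_⟩
    rw [pointMeasure_apply ω hB, ENat.toENNReal_iSup]
    simp
  · have := hmeas B hB
    have : IsProbabilityMeasure (P.map fun ω => pointMeasure ω B) :=
      Measure.isProbabilityMeasure_map (hmeas B hB).aemeasurable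
    refine Measure.ext_of_Iic _ _ fun a => ?_
    rw [Measure.map_apply (hmeas B hB) measurableSet_Iic,
      Measure.map_apply (by fun_prop) measurableSet_Iic]
    refine tendsto_nhds_unique (hcdf B hB a) ?_
    change Tendsto _ _ (𝓝 (poissonMeasure (μ B).toNNReal {k | (k : ℝ≥0∞) ≤ a}))
    by_cases ha : a = ∞
    · simp [ha]
    obtain ⟨F, hF⟩ := hfin a ha
    rw [hF]
    refine ((poissonMeasure_continuous_finset F).tendsto _).comp ?_
    exact (ENNReal.tendsto_toNNReal hlt.ne).comp (hμB B hB)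
  · have h1 : ∀ a : ℕ, P {ω | pointMeasure ω B ≤ a} = 0 := by
      intro a
      obtain ⟨F, hF⟩ := hfin a (by simp)
      refine tendsto_nhds_unique (hcdf B hB a) ?_
      rw [hF]
      refine (tendsto_poissonMeasure_finset_atTop F).comp ?_
      have h := hμB B hB
      rw [htop] at h
      exact ENNReal.tendsto_coe_nhds_top.1 h
    have h2 : ∀ᵐ ω ∂P, ∀ a : ℕ, ¬ pointMeasure ω B ≤ a :=
      ae_all_iff.2 fun a => by rw [ae_iff]; simpa using h1 a
    filter_upwards [h2] with ω hω
    by_contra hne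
    obtain ⟨a, ha⟩ := ENNReal.exists_nat_gt hne
    exact hω a ha.le
  · simp_rw [pointMeasure_apply _ (hB _)]
    have hm := fun J l => measurable_partialCount J (hB l)
    exact iIndepFun_iSup (M := fun J l ω => (partialCount J (B l) ω : ℝ≥0∞))
      (fun J l => by fun_prop) (fun l ω => monotone_partialCount (B l) ω)
      fun J => iIndepFun_partialCount r p J hB hd

/-- Existence of Poisson random measures. -/
theorem exists_isPoissonRandomMeasure [Nonempty E] (μ : Measure E) [SFinite μ] :
    ∃ (Ω : Type u) (_ : MeasurableSpace Ω) (P : Measure Ω) (N : Ω → Measure E),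
      IsProbabilityMeasure P ∧ IsPoissonRandomMeasure μ N P := by
  have h1 : ∀ m : Measure E, IsFiniteMeasure m →
      ∃ (r : ℝ≥0) (p : Measure E), IsProbabilityMeasure p ∧ m = r • p := by
    intro m hm
    by_cases h0 : m = 0
    -- The zero measure cannot be normalised; rate `0` with any point mass represents it.
    · exact ⟨0, Measure.dirac (Classical.arbitrary E), inferInstance, by simp [h0]⟩
    · have : NeZero m := ⟨h0⟩
      refine ⟨(m univ).toNNReal, (m univ)⁻¹ • m, inferInstance, ?_⟩
      ext s _
      rw [Measure.smul_apply, Measure.smul_apply, ENNReal.smul_def,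
        ENNReal.coe_toNNReal (measure_ne_top _ _), smul_eq_mul, smul_eq_mul, ← mul_assoc,
        ENNReal.mul_inv_cancel (by simpa using h0) (measure_ne_top _ _), one_mul]
  choose r p hp hrp using fun j => h1 (sfiniteSeq μ j) inferInstance
  refine ⟨ℕ → ℕ × (ℕ → E), inferInstance, Measure.infinitePi fun j => poissonSampleLaw (r j) (p j),
    pointMeasure, inferInstance, isPoissonRandomMeasure_pointMeasure r p ?_⟩
  simp_rw [← hrp]
  exact (sum_sfiniteSeq μ).symm

end PoissonRandomMeasure

/-! ### Integrals against a Poisson random measure -/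

section PoissonIntegral

open Filter Topology

/-- Finite total mass allows only finitely many atoms of mass at least 1, and integrality makes all
other atoms null. -/
lemma exists_finset_compl_null_of_integer {κ : Type*} [MeasurableSpace κ] [Countable κ]
    [MeasurableSingletonClass κ] {m : Measure κ} [IsFiniteMeasure m]
    (hint : ∀ k, ∃ j : ℕ∞, m {k} = (j : ℝ≥0∞)) : ∃ F : Finset κ, m (F : Set κ)ᶜ = 0 := by
  have hsum : ∑' k, m {k} = m univ := by
    simpa using Measure.tsum_indicator_apply_singleton m univ MeasurableSet.univ
  have hfin : {k | 1 ≤ m {k}}.Finite :=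
    ENNReal.finite_const_le_of_tsum_ne_top (hsum ▸ measure_ne_top m univ) one_ne_zero
  refine ⟨hfin.toFinset, ?_⟩
  rw [measure_null_iff_singleton (to_countable _)]
  intro k hk
  obtain ⟨j, hj⟩ := hint k
  have hk' : m {k} < 1 := by simpa using hk
  rw [hj] at hk' ⊢
  have : j < 1 := by exact_mod_cast hk'
  simpa using Order.lt_one_iff.1 this

variable {E κ V : Type*} [MeasurableSpace E] [MeasurableSpace κ] [Countable κ]
  [MeasurableSingletonClass κ] [NormedAddCommGroup V] [NormedSpace ℝ V] [CompleteSpace V]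

/-- Against an integer-valued measure that is finite on `D`, functions factoring through a countable
space are integrable on `D`, and their integrals are finite sums. -/
lemma integrableOn_and_tendsto_of_integer {m : Measure E}
    (hint : ∀ B, MeasurableSet B → ∃ j : ℕ∞, m B = (j : ℝ≥0∞)) {D : Set E}
    (hD : MeasurableSet D) (hDm : m D < ∞) {g : E → κ} (hg : Measurable g) (c : κ → V) :
    IntegrableOn (fun x => c (g x)) D m ∧
      Tendsto (fun F : Finset κ => ∑ k ∈ F, (m (D ∩ g ⁻¹' {k})).toReal • c k) atTop
        (𝓝 (∫ x in D, c (g x) ∂m)) := by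
  classical
  have hd : DiscreteMeasurableSpace κ := inferInstance
  have : IsFiniteMeasure (m.restrict D) := ⟨by simpa using hDm⟩
  set m' := (m.restrict D).map g with hm'
  have hs : ∀ k, m' {k} = m (D ∩ g ⁻¹' {k}) := fun k => by
    rw [hm', Measure.map_apply hg (measurableSet_singleton k),
      Measure.restrict_apply (hg (measurableSet_singleton k)), inter_comm]
  obtain ⟨F₀, hF₀⟩ := exists_finset_compl_null_of_integer (m := m') fun k => by
    rw [hs k]; exact hint _ (hD.inter (hg (measurableSet_singleton k)))
  have hcm : AEStronglyMeasurable c m' := .of_discrete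
  have hci : Integrable c m' := by
    refine Integrable.of_bound hcm (∑ k ∈ F₀, ‖c k‖) ?_
    filter_upwards [measure_eq_zero_iff_ae_notMem.1 hF₀] with k hk
    exact Finset.single_le_sum (f := fun k => ‖c k‖) (fun _ _ => norm_nonneg _) (by simpa using hk)
  have hmap : ∫ x in D, c (g x) ∂m = ∫ k, c k ∂m' := by
    rw [hm', integral_map hg.aemeasurable hcm]
  refine ⟨(integrable_map_measure hcm hg.aemeasurable).1 hci, ?_⟩
  rw [hmap]
  -- The net is eventually constant: once `F` contains `F₀`, the sum is the whole integral.
  refine tendsto_const_nhds.congr' ?_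
  filter_upwards [eventually_ge_atTop F₀] with F hF
  have h1 : ∫ k, c k ∂m' = ∫ k in (F : Set κ), c k ∂m' := by
    rw [Measure.restrict_eq_self_of_ae_mem]
    filter_upwards [measure_eq_zero_iff_ae_notMem.1 hF₀] with k hk
    exact hF (by simpa using hk)
  rw [h1, setIntegral_finset _ hci.integrableOn]
  exact Finset.sum_congr rfl fun k _ => by rw [measureReal_def, hs]

variable {Ω : Type*} [MeasurableSpace Ω] {P : Measure Ω} {μ : Measure E} {N : Ω → Measure E}

namespace IsPoissonRandomMeasure

lemma ae_lt_top (hN : IsPoissonRandomMeasure μ N P) {D : Set E} (hD : MeasurableSet D)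
    (hμD : μ D < ∞) : ∀ᵐ ω ∂P, N ω D < ∞ := by
  have h := congrArg (fun m => m {∞}) (hN.law_of_finite D hD hμD)
  rw [Measure.map_apply (hN.measurable D hD) (measurableSet_singleton _),
    Measure.map_apply (by fun_prop) (measurableSet_singleton _)] at h
  have h2 : (fun k : ℕ => (k : ℝ≥0∞)) ⁻¹' {∞} = ∅ := by ext k; simp
  rw [h2, measure_empty] at h
  filter_upwards [measure_eq_zero_iff_ae_notMem.1 h] with ω hω
  exact lt_top_iff_ne_top.2 hω

lemma ae_eq_zero (hN : IsPoissonRandomMeasure μ N P) {D : Set E} (hD : MeasurableSet D)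
    (hμD : μ D = 0) : ∀ᵐ ω ∂P, N ω D = 0 := by
  have h := congrArg (fun m => m {0}ᶜ) (hN.law_of_finite D hD (by simp [hμD]))
  rw [Measure.map_apply (hN.measurable D hD) (measurableSet_singleton _).compl,
    Measure.map_apply (by fun_prop) (measurableSet_singleton _).compl] at h
  have h2 : (fun k : ℕ => (k : ℝ≥0∞)) ⁻¹' {0}ᶜ = {0}ᶜ := by ext k; simp
  rw [h2, prob_compl_eq_one_sub (measurableSet_singleton _), poissonMeasure_singleton, hμD] at h
  simp only [ENNReal.toNNReal_zero, NNReal.coe_zero, neg_zero, Real.exp_zero, pow_zero, mul_one,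
    Nat.factorial_zero, Nat.cast_one, div_one, ENNReal.ofReal_one, tsub_self] at h
  filter_upwards [measure_eq_zero_iff_ae_notMem.1 h] with ω hω
  simpa using hω

lemma iIndepFun_fintype (hN : IsPoissonRandomMeasure μ N P) {ι : Type*} [Fintype ι]
    {B : ι → Set E} (hB : ∀ i, MeasurableSet (B i)) (hd : Pairwise (Disjoint on B)) :
    iIndepFun (fun i ω => N ω (B i)) P := by
  have e := Fintype.equivFin ι
  have h := hN.indep (Fintype.card ι) (fun j => B (e.symm j)) (fun j => hB _)
    (fun a b hab => hd (e.symm.injective.ne hab))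
  simpa using h.precomp e.injective

lemma integral_exp_count (hN : IsPoissonRandomMeasure μ N P) {B : Set E} (hB : MeasurableSet B)
    (hμB : μ B < ∞) (x : ℝ) :
    ∫ ω, Complex.exp (Complex.I * (((N ω B).toReal * x : ℝ) : ℂ)) ∂P =
      Complex.exp ((μ B).toReal * (Complex.exp (Complex.I * x) - 1)) := by
  have h1 := integral_map (μ := P) (hN.measurable B hB).aemeasurable
    (f := fun z : ℝ≥0∞ => Complex.exp (Complex.I * ((z.toReal * x : ℝ) : ℂ)))
    (Measurable.aestronglyMeasurable (by fun_prop))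
  rw [← h1, hN.law_of_finite B hB hμB, integral_map (by fun_prop)
    (Measurable.aestronglyMeasurable (by fun_prop))]
  have h2 := charFun_map_cast_poissonMeasure (μ B).toNNReal x
  rw [charFun_apply_real, integral_map (by fun_prop) (by fun_prop)] at h2
  rw [mul_comm Complex.I (x : ℂ)]
  refine Eq.trans ?_ h2
  refine integral_congr_ae (ae_of_all _ fun k => ?_)
  simp only [ENNReal.toReal_natCast]
  congr 1
  push_cast
  ring

lemma aemeasurable_integral [SecondCountableTopology V] [MeasurableSpace V] [BorelSpace V]
    (hN : IsPoissonRandomMeasure μ N P) {D : Set E}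
    (hD : MeasurableSet D) (hμD : μ D < ∞) {g : E → κ} (hg : Measurable g) (c : κ → V) :
    AEMeasurable (fun ω => ∫ x in D, c (g x) ∂(N ω)) P := by
  refine aemeasurable_of_tendsto_metrizable_ae (atTop : Filter (Finset κ))
    (f := fun F ω => ∑ k ∈ F, (N ω (D ∩ g ⁻¹' {k})).toReal • c k) (fun F => ?_) ?_
  · refine (Finset.measurable_fun_sum _ fun k _ => ?_).aemeasurable
    have := hN.measurable _ (hD.inter (hg (measurableSet_singleton k)))
    fun_prop
  · filter_upwards [hN.ae_lt_top hD hμD] with ω hω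
    exact (integrableOn_and_tendsto_of_integer (hN.integer ω) hD hω hg c).2

/-- The characteristic function of a Poisson integral. -/
theorem integral_exp_integral [IsProbabilityMeasure P] (hN : IsPoissonRandomMeasure μ N P)
    {D : Set E} (hD : MeasurableSet D) (hμD : μ D < ∞) {g : E → κ} (hg : Measurable g)
    (c : κ → ℝ) :
    ∫ ω, Complex.exp (Complex.I * ((∫ x in D, c (g x) ∂(N ω) : ℝ) : ℂ)) ∂P =
      Complex.exp (∫ x in D, (Complex.exp (Complex.I * c (g x)) - 1) ∂μ) := by
  have hd : DiscreteMeasurableSpace κ := inferInstance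
  have hcell : ∀ k, MeasurableSet (D ∩ g ⁻¹' {k}) := fun k =>
    hD.inter (hg (measurableSet_singleton k))
  have hcellfin : ∀ k, μ (D ∩ g ⁻¹' {k}) < ∞ := fun k =>
    (measure_mono inter_subset_left).trans_lt hμD
  have hNm : ∀ k, Measurable fun ω => N ω (D ∩ g ⁻¹' {k}) := fun k => hN.measurable _ (hcell k)
  have hfin : ∀ F : Finset κ,
      ∫ ω, Complex.exp (Complex.I *
        ((∑ k ∈ F, (N ω (D ∩ g ⁻¹' {k})).toReal • c k : ℝ) : ℂ)) ∂P =
      Complex.exp (∑ k ∈ F, (μ (D ∩ g ⁻¹' {k})).toReal * (Complex.exp (Complex.I * c k) - 1)) := by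
    intro F
    -- The cells `D ∩ g ⁻¹' {k}` are disjoint, so their counts are independent Poisson variables and
    -- the exponential factorizes.
    have hind := hN.iIndepFun_fintype (ι := F) (B := fun k => D ∩ g ⁻¹' {(k : κ)})
      (fun k => hcell k) fun a b hab => by
        refine Disjoint.mono inter_subset_right inter_subset_right (Disjoint.preimage _ ?_)
        exact Set.disjoint_singleton.2 fun h => hab (Subtype.ext h)
    have hind2 := hind.comp
      (fun (k : F) (z : ℝ≥0∞) => Complex.exp (Complex.I * ((z.toReal * c k : ℝ) : ℂ)))
      (fun k => by fun_prop)
    have h1 := hind2.integral_fun_prod_eq_prod_integral fun k => by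
      have := hNm k
      exact Measurable.aestronglyMeasurable (by fun_prop)
    simp only [comp_apply] at h1
    rw [Finset.prod_congr rfl fun (k : F) _ =>
        hN.integral_exp_count (hcell (k : κ)) (hcellfin _) (c k),
      Finset.prod_coe_sort F (fun k => Complex.exp ((μ (D ∩ g ⁻¹' {k})).toReal *
        (Complex.exp (Complex.I * c k) - 1))), ← Complex.exp_sum] at h1
    rw [← h1]
    refine integral_congr_ae (ae_of_all _ fun ω => ?_)
    simp only
    rw [Finset.prod_coe_sort F (fun k => Complex.exp (Complex.I *
      (((N ω (D ∩ g ⁻¹' {k})).toReal * c k : ℝ) : ℂ))), ← Complex.exp_sum, ← Finset.mul_sum,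
      ← Complex.ofReal_sum]
    rfl
  -- Countability of `κ` makes `atTop` on `Finset κ` countably generated, as dominated convergence
  -- requires.
  have hL : Tendsto (fun F : Finset κ => ∫ ω, Complex.exp (Complex.I *
        ((∑ k ∈ F, (N ω (D ∩ g ⁻¹' {k})).toReal • c k : ℝ) : ℂ)) ∂P) atTop
      (𝓝 (∫ ω, Complex.exp (Complex.I * ((∫ x in D, c (g x) ∂(N ω) : ℝ) : ℂ)) ∂P)) := by
    refine tendsto_integral_filter_of_dominated_convergence (fun _ => 1)
      (Eventually.of_forall fun F => ?_) (Eventually.of_forall fun F => ae_of_all _ fun ω => ?_)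
      (integrable_const _) ?_
    · exact Measurable.aestronglyMeasurable (by fun_prop)
    · rw [mul_comm, Complex.norm_exp_ofReal_mul_I]
    · filter_upwards [hN.ae_lt_top hD hμD] with ω hω
      have h := (integrableOn_and_tendsto_of_integer (hN.integer ω) hD hω hg c).2
      have hcont : Continuous fun y : ℝ => Complex.exp (Complex.I * (y : ℂ)) := by fun_prop
      exact (hcont.tendsto _).comp h
  have : IsFiniteMeasure (μ.restrict D) := ⟨by simpa using hμD⟩
  have hR : Tendsto (fun F : Finset κ => ∑ k ∈ F, ((μ (D ∩ g ⁻¹' {k})).toReal : ℂ) *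
      (Complex.exp (Complex.I * c k) - 1)) atTop
      (𝓝 (∫ x in D, (Complex.exp (Complex.I * c (g x)) - 1) ∂μ)) := by
    set f : κ → ℂ := fun k => Complex.exp (Complex.I * c k) - 1 with hf
    set m' := (μ.restrict D).map g with hm'
    have hfm : AEStronglyMeasurable f m' := (measurable_of_countable f).aestronglyMeasurable
    have hfi : Integrable f m' := by
      refine Integrable.of_bound hfm 2 (ae_of_all _ fun k => (norm_sub_le _ _).trans ?_)
      rw [mul_comm, Complex.norm_exp_ofReal_mul_I]
      norm_num
    have h1 : ∫ x in D, (Complex.exp (Complex.I * c (g x)) - 1) ∂μ = ∫ k, f k ∂m' := by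
      rw [hm', integral_map hg.aemeasurable hfm]
    have h2 := tendsto_setIntegral_of_monotone (μ := m') (f := f)
      (s := fun F : Finset κ => (F : Set κ)) (fun _ => MeasurableSet.of_discrete)
      (fun _ _ h => Finset.coe_subset.2 h) hfi.integrableOn
    have h3 : ⋃ F : Finset κ, (F : Set κ) = univ :=
      eq_univ_of_forall fun k => mem_iUnion.2 ⟨{k}, by simp⟩
    rw [h3, setIntegral_univ] at h2
    rw [h1]
    refine h2.congr fun F => ?_
    rw [setIntegral_finset _ hfi.integrableOn]
    refine Finset.sum_congr rfl fun k _ => ?_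
    rw [measureReal_def, hm', Measure.map_apply hg (measurableSet_singleton k),
      Measure.restrict_apply (hg (measurableSet_singleton k)), inter_comm, Complex.real_smul]
  refine tendsto_nhds_unique hL ?_
  simp_rw [hfin]
  exact (Complex.continuous_exp.tendsto _).comp hR

end IsPoissonRandomMeasure

end PoissonIntegral

/-! ### Lévy bases, trawl processes and stationarity -/

section Trawl

open Filter Topology

variable {n : ℕ}

/-- Coordinatewise integer part, a left inverse of `intVec`. -/
noncomputable def floorVec (y : EuclideanSpace ℝ (Fin n)) : Fin n → ℤ := fun i => ⌊y i⌋

lemma floorVec_intVec (k : Fin n → ℤ) : floorVec (intVec n k) = k := by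
  ext i; simp [floorVec, intVec]

lemma measurable_floorVec : Measurable (floorVec (n := n)) :=
  measurable_pi_lambda _ fun i => Int.measurable_floor.comp (by fun_prop)

lemma measurableSet_range_intVec : MeasurableSet (range (intVec n)) :=
  (countable_range _).measurableSet

lemma one_le_norm_intVec {k : Fin n → ℤ} (hk : intVec n k ≠ 0) : 1 ≤ ‖intVec n k‖ := by
  have : ∃ i, k i ≠ 0 := by
    by_contra! h
    exact hk (by ext i; simp [intVec, h i])
  obtain ⟨i, hi⟩ := this
  calc (1 : ℝ) ≤ |(k i : ℝ)| := by rw [← Int.cast_abs]; exact_mod_cast Int.one_le_abs hi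
    _ = ‖intVec n k i‖ := by simp [intVec]
    _ ≤ ‖intVec n k‖ := PiLp.norm_apply_le _ i

variable {ν : Measure (EuclideanSpace ℝ (Fin n))}

namespace IsIntegerLevyMeasure

/-- Nonzero lattice points have norm at least 1, so the integrand `min 1 ‖y‖ₑ` is almost everywhere
1. -/
lemma isFiniteMeasure (hν : IsIntegerLevyMeasure ν) : IsFiniteMeasure ν := by
  refine ⟨lt_of_le_of_lt ?_ hν.lintegral_lt_top⟩
  rw [← lintegral_one]
  refine lintegral_mono_ae ?_
  filter_upwards [measure_eq_zero_iff_ae_notMem.1 hν.concentrated] with y hy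
  simp only [mem_compl_iff, not_not] at hy
  obtain ⟨⟨k, rfl⟩, hk⟩ := hy
  refine le_min le_rfl ?_
  rw [← ofReal_norm, ENNReal.one_le_ofReal]
  exact one_le_norm_intVec hk

lemma measure_compl_range (hν : IsIntegerLevyMeasure ν) : ν (range (intVec n))ᶜ = 0 :=
  measure_mono_null (compl_subset_compl.2 sdiff_subset) hν.concentrated

lemma ae_intVec_floorVec (hν : IsIntegerLevyMeasure ν) : ∀ᵐ y ∂ν, intVec n (floorVec y) = y := by
  filter_upwards [measure_eq_zero_iff_ae_notMem.1 hν.measure_compl_range] with y hy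
  simp only [mem_compl_iff, not_not] at hy
  obtain ⟨k, rfl⟩ := hy
  rw [floorVec_intVec]

lemma jumpIntensity_prod_lt_top (hν : IsIntegerLevyMeasure ν) {B : Set (I × ℝ)}
    (hB : volume B < ∞) : jumpIntensity ν (univ ×ˢ B) < ∞ := by
  have := hν.isFiniteMeasure
  rw [jumpIntensity, Measure.prod_prod]
  exact ENNReal.mul_lt_top (measure_lt_top _ _) hB

end IsIntegerLevyMeasure

section LevyBasis

variable {Ω : Type*} [MeasurableSpace Ω] {P : Measure Ω} {N : Ω → Measure (JumpSpace n)}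
  (hν : IsIntegerLevyMeasure ν) (hN : IsPoissonRandomMeasure (jumpIntensity ν) N P)

include hν hN

/-- Jumps off the lattice have zero intensity and almost surely do not occur. The integrand `y` thus
becomes a function of the countably-valued `floorVec y`, to which the Poisson integral results
apply. -/
lemma ae_ae_intVec_floorVec : ∀ᵐ ω ∂P, ∀ᵐ p ∂(N ω), intVec n (floorVec p.1) = p.1 := by
  have hm : MeasurableSet ((range (intVec n))ᶜ ×ˢ (univ : Set (I × ℝ))) :=
    measurableSet_range_intVec.compl.prod MeasurableSet.univ
  filter_upwards [hN.ae_eq_zero hm (by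
    rw [jumpIntensity, Measure.prod_prod, hν.measure_compl_range, zero_mul])] with ω hω
  filter_upwards [measure_eq_zero_iff_ae_notMem.1 hω] with p hp
  simp only [mem_prod, mem_compl_iff, mem_univ, and_true, not_not] at hp
  obtain ⟨k, hk⟩ := hp
  rw [← hk, floorVec_intVec]

lemma ae_levyBasis_eq (B : Set (I × ℝ)) : ∀ᵐ ω ∂P,
    levyBasis N B ω = ∫ p in univ ×ˢ B, intVec n (floorVec p.1) ∂(N ω) := by
  filter_upwards [ae_ae_intVec_floorVec hν hN] with ω hω
  refine integral_congr_ae (ae_restrict_of_ae ?_)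
  filter_upwards [hω] with p hp using hp.symm

lemma aemeasurable_levyBasis {B : Set (I × ℝ)} (hB : MeasurableSet B) (hBv : volume B < ∞) :
    AEMeasurable (levyBasis N B) P := by
  refine AEMeasurable.congr ?_ ((ae_levyBasis_eq hν hN B).mono fun ω h => h.symm)
  exact hN.aemeasurable_integral (MeasurableSet.univ.prod hB) (hν.jumpIntensity_prod_lt_top hBv)
    (g := fun p => floorVec p.1) (measurable_floorVec.comp measurable_fst) (intVec n)

open Classical in
/-- The joint characteristic function of the values of the Lévy basis on finitely many sets. -/
theorem integral_exp_sum_levyBasis [IsProbabilityMeasure P] {ι : Type*} [Fintype ι]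
    {B : ι → Set (I × ℝ)} (hB : ∀ i, MeasurableSet (B i)) (hBv : ∀ i, volume (B i) < ∞)
    (ℓ : ι → StrongDual ℝ (EuclideanSpace ℝ (Fin n))) :
    ∫ ω, Complex.exp (Complex.I * ((∑ i, ℓ i (levyBasis N (B i) ω) : ℝ) : ℂ)) ∂P =
      Complex.exp (∫ p, (Complex.exp (Complex.I *
        ((∑ i, (B i).indicator (fun _ => ℓ i (intVec n (floorVec p.1))) p.2 : ℝ) : ℂ)) - 1)
          ∂(jumpIntensity ν)) := by
  set D : Set (JumpSpace n) := univ ×ˢ ⋃ i, B i with hDdef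
  have hD : MeasurableSet D := MeasurableSet.univ.prod (MeasurableSet.iUnion hB)
  have hDv : jumpIntensity ν D < ∞ := by
    refine hν.jumpIntensity_prod_lt_top ((measure_iUnion_le _).trans_lt ?_)
    rw [tsum_fintype]
    exact ENNReal.sum_lt_top.2 fun i _ => hBv i
  -- `g` records the lattice jump and which of the sets contain its location, a countable amount of
  -- data. The whole linear combination is then a single Poisson integral over `D`, with no
  -- disjointness of the `B i` needed.
  set g : JumpSpace n → (Fin n → ℤ) × (ι → Prop) := fun p => (floorVec p.1, fun i => p.2 ∈ B i)
    with hg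
  have hgm : Measurable g :=
    (measurable_floorVec.comp measurable_fst).prodMk
      (measurable_pi_lambda _ fun i => (hB i).mem.comp measurable_snd)
  set c : (Fin n → ℤ) × (ι → Prop) → ℝ := fun q => ∑ i, if q.2 i then ℓ i (intVec n q.1) else 0
    with hc
  have hcg : ∀ p, c (g p) = ∑ i, (B i).indicator (fun _ => ℓ i (intVec n (floorVec p.1))) p.2 :=
    fun p => by simp [hc, hg, indicator_apply]
  have h := hN.integral_exp_integral hD hDv hgm c
  have hR : ∫ p in D, (Complex.exp (Complex.I * c (g p)) - 1) ∂(jumpIntensity ν) =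
      ∫ p, (Complex.exp (Complex.I * c (g p)) - 1) ∂(jumpIntensity ν) := by
    refine setIntegral_eq_integral_of_forall_compl_eq_zero fun p hp => ?_
    have hp' : ∀ i, p.2 ∉ B i := by simpa [hDdef] using hp
    rw [hcg]
    simp [hp']
  simp_rw [← hcg]
  rw [← hR, ← h]
  refine integral_congr_ae ?_
  filter_upwards [ae_all_iff.2 fun i => ae_levyBasis_eq hν hN (B i), hN.ae_lt_top hD hDv]
    with ω hω hfin
  congr 3
  have hfini : ∀ i, IntegrableOn (fun p : JumpSpace n => intVec n (floorVec p.1)) (univ ×ˢ B i) (N ω) := by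
    intro i
    refine (integrableOn_and_tendsto_of_integer (hN.integer ω) (MeasurableSet.univ.prod (hB i))
      ?_ (g := fun p => floorVec p.1) (measurable_floorVec.comp measurable_fst) (intVec n)).1
    exact (measure_mono (prod_mono_right (subset_iUnion B i))).trans_lt hfin
  have hsub : ∀ i, (univ : Set (EuclideanSpace ℝ (Fin n))) ×ˢ B i ⊆ D := fun i =>
    prod_mono_right (subset_iUnion B i)
  have h1 : ∀ i, ℓ i (levyBasis N (B i) ω) = ∫ p in D, (univ ×ˢ B i).indicator
      (fun p : JumpSpace n => ℓ i (intVec n (floorVec p.1))) p ∂(N ω) := by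
    intro i
    rw [hω i, ← ContinuousLinearMap.integral_comp_comm _ (hfini i),
      setIntegral_indicator (MeasurableSet.univ.prod (hB i)), inter_eq_right.2 (hsub i)]
  simp_rw [h1]
  rw [← integral_finsetSum]
  · refine integral_congr_ae (ae_of_all _ fun p => ?_)
    simp only [hcg]
    refine Finset.sum_congr rfl fun i _ => ?_
    by_cases hp : p.2 ∈ B i <;> simp [hp]
  · intro i _
    refine IntegrableOn.integrable ?_
    refine (integrable_indicator_iff (MeasurableSet.univ.prod (hB i))).2 ?_
    refine IntegrableOn.mono_measure ?_ Measure.restrict_le_self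
    exact (ℓ i).integrable_comp (hfini i)

end LevyBasis

lemma measurableSet_trawlAt {A : Set (I × ℝ)} (hA : MeasurableSet A) (t : ℝ) :
    MeasurableSet (trawlAt A t) :=
  hA.preimage (f := fun p : I × ℝ => (p.1, p.2 - t)) (by fun_prop)

lemma measurePreserving_shift (t : ℝ) :
    MeasurePreserving (fun p : I × ℝ => (p.1, p.2 - t)) volume volume :=
  (MeasurePreserving.id volume).prod (measurePreserving_sub_right volume t)

lemma volume_trawlAt {A : Set (I × ℝ)} (hA : MeasurableSet A) (t : ℝ) :
    volume (trawlAt A t) = volume A :=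
  (measurePreserving_shift t).measure_preimage hA.nullMeasurableSet

lemma measurePreserving_jumpIntensity [SFinite ν] (t : ℝ) :
    MeasurePreserving (fun p : JumpSpace n => (p.1, (p.2.1, p.2.2 - t)))
      (jumpIntensity ν) (jumpIntensity ν) :=
  (MeasurePreserving.id ν).prod (measurePreserving_shift t)

lemma trawlProcess_const {Ω : Type*} (N : Ω → Measure (JumpSpace n)) (A : Set (I × ℝ)) (t : ℝ) :
    trawlProcess N (fun _ => A) t = levyBasis N (trawlAt A t) := rfl

section Marginals

variable {Ω : Type*} [MeasurableSpace Ω] {P : Measure Ω} {N : Ω → Measure (JumpSpace n)}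
  {A : Set (I × ℝ)}

lemma aemeasurable_trawlProcess (hν : IsIntegerLevyMeasure ν)
    (hN : IsPoissonRandomMeasure (jumpIntensity ν) N P) (hA : IsTrawl A) (t : ℝ) :
    AEMeasurable (trawlProcess N (fun _ => A) t) P :=
  aemeasurable_levyBasis hν hN (measurableSet_trawlAt hA.measurableSet t)
    (by rw [volume_trawlAt hA.measurableSet]; exact hA.volume_lt_top)

/-- The marginal characteristic function of a trawl process. -/
theorem integral_exp_trawlProcess [IsProbabilityMeasure P] (hν : IsIntegerLevyMeasure ν)
    (hN : IsPoissonRandomMeasure (jumpIntensity ν) N P) (hA : IsTrawl A) (t : ℝ)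
    (θ : EuclideanSpace ℝ (Fin n)) :
    ∫ ω, Complex.exp
        (Complex.I * ((inner ℝ θ (trawlProcess N (fun _ => A) t ω) : ℝ) : ℂ)) ∂P =
      Complex.exp (((volume A).toReal : ℂ) * seedCumulant ν θ) := by
  have := hν.isFiniteMeasure
  have hm := measurableSet_trawlAt hA.measurableSet t
  have hv := volume_trawlAt hA.measurableSet t
  have h := integral_exp_sum_levyBasis hν hN (ι := Unit) (B := fun _ => trawlAt A t) (fun _ => hm)
    (fun _ => by rw [hv]; exact hA.volume_lt_top) (fun _ => innerSL ℝ θ)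
  simp only [Finset.univ_unique, Finset.sum_singleton, innerSL_apply_apply] at h
  rw [trawlProcess_const, h]
  congr 1
  -- The integrand is a function of the jump times an indicator of its location, so the product
  -- intensity splits it into the seed cumulant and `Leb(A)`.
  have h1 : ∀ p : JumpSpace n, Complex.exp (Complex.I * (((trawlAt A t).indicator
      (fun _ => (inner ℝ θ (intVec n (floorVec p.1)) : ℝ)) p.2 : ℝ) : ℂ)) - 1 =
      (Complex.exp (Complex.I * ((inner ℝ θ (intVec n (floorVec p.1)) : ℝ) : ℂ)) - 1) *
        (trawlAt A t).indicator (fun _ => (1 : ℂ)) p.2 := by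
    intro p
    by_cases hp : p.2 ∈ trawlAt A t <;> simp [hp]
  simp_rw [h1]
  rw [jumpIntensity, integral_prod_mul (fun y : EuclideanSpace ℝ (Fin n) =>
    Complex.exp (Complex.I * ((inner ℝ θ (intVec n (floorVec y)) : ℝ) : ℂ)) - 1), mul_comm]
  congr 1
  · rw [integral_indicator hm, setIntegral_const, measureReal_def, hv]
    simp
  · refine integral_congr_ae ?_
    filter_upwards [hν.ae_intVec_floorVec] with y hy
    rw [hy]

/-- Joint characteristic functions see the trawls only through an integral against the intensity,
which is invariant under the time shift carrying the sets at times `t i` to those at `t i + h`. -/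
theorem isStationaryProcess_trawlProcess [IsProbabilityMeasure P] (hν : IsIntegerLevyMeasure ν)
    (hN : IsPoissonRandomMeasure (jumpIntensity ν) N P) (hA : IsTrawl A) :
    IsStationaryProcess (trawlProcess N (fun _ => A)) P := by
  have := hν.isFiniteMeasure
  have hY := aemeasurable_trawlProcess hν hN hA
  refine ⟨hY, fun k t h => ?_⟩
  have hYv : ∀ s : Fin k → ℝ, AEMeasurable (fun ω i => trawlProcess N (fun _ => A) (s i) ω) P :=
    fun s => aemeasurable_pi_lambda _ fun i => hY (s i)
  have hprob : ∀ s : Fin k → ℝ, IsProbabilityMeasure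
      (P.map (fun ω i => trawlProcess N (fun _ => A) (s i) ω)) :=
    fun s => Measure.isProbabilityMeasure_map (hYv s)
  have := hprob t
  have := hprob fun i => t i + h
  have hchar : ∀ (s : Fin k → ℝ) (L : StrongDual ℝ (Fin k → EuclideanSpace ℝ (Fin n))),
      charFunDual (P.map (fun ω i => trawlProcess N (fun _ => A) (s i) ω)) L =
      Complex.exp (∫ p, (Complex.exp (Complex.I * ((∑ i, (trawlAt A (s i)).indicator (fun _ =>
        (L.comp (.single ℝ (fun _ => EuclideanSpace ℝ (Fin n)) i)) (intVec n (floorVec p.1))) p.2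
          : ℝ) : ℂ)) - 1) ∂(jumpIntensity ν)) := by
    intro s L
    rw [← integral_exp_sum_levyBasis hν hN
      (fun i => measurableSet_trawlAt hA.measurableSet (s i))
      (fun i => by rw [volume_trawlAt hA.measurableSet]; exact hA.volume_lt_top),
      charFunDual_apply, integral_map (hYv s) (by fun_prop)]
    refine integral_congr_ae (ae_of_all _ fun ω => ?_)
    simp only [trawlProcess_const, mul_comm Complex.I]
    congr 3
    -- A functional on the vector of values splits into one functional per time, the form required
    -- by `integral_exp_sum_levyBasis`.
    conv_lhs => rw [← Finset.univ_sum_single (fun i => levyBasis N (trawlAt A (s i)) ω), map_sum]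
    rfl
  refine Measure.ext_of_charFunDual (funext fun L => ?_)
  rw [hchar, hchar]
  congr 1
  have hmp := measurePreserving_jumpIntensity (ν := ν) h
  have hemb : MeasurableEmbedding fun p : JumpSpace n => (p.1, (p.2.1, p.2.2 - h)) :=
    (MeasurableEmbedding.id).prodMap
      ((MeasurableEmbedding.id).prodMap (MeasurableEquiv.subRight h).measurableEmbedding)
  symm
  rw [← hmp.integral_comp hemb]
  refine integral_congr_ae (ae_of_all _ fun p => ?_)
  simp only
  congr 4
  refine congrArg _ (funext fun i => ?_)
  have : p.2 ∈ trawlAt A (t i + h) ↔ (p.2.1, p.2.2 - h) ∈ trawlAt A (t i) := by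
    simp only [trawlAt, mem_ofPred_eq, sub_sub, add_comm]
  by_cases hp : p.2 ∈ trawlAt A (t i + h)
  · rw [indicator_of_mem hp, indicator_of_mem (this.1 hp)]
  · rw [indicator_of_notMem hp, indicator_of_notMem fun h' => hp (this.2 h')]

end Marginals

lemma isIntegerLevyMeasure_map_intVec {η : Measure (Fin n → ℤ)} [IsFiniteMeasure η]
    (h0 : η {0} = 0) : IsIntegerLevyMeasure (η.map (intVec n)) := by
  have hm := measurable_intVec n
  have : IsFiniteMeasure (η.map (intVec n)) := Measure.isFiniteMeasure_map _ _
  have hz : ∀ k, intVec n k = 0 ↔ k = 0 := fun k => by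
    constructor
    · intro h
      ext i
      simpa [intVec] using congrArg (fun y : EuclideanSpace ℝ (Fin n) => y i) h
    · rintro rfl; ext i; simp [intVec]
  have hlt : ∀ f : EuclideanSpace ℝ (Fin n) → ℝ≥0∞,
      ∫⁻ y, min 1 (f y) ∂(η.map (intVec n)) < ∞ := fun f =>
    (lintegral_mono fun y => min_le_left _ _).trans_lt (by simp [measure_lt_top])
  refine ⟨⟨?_, hlt _⟩, ?_, hlt _⟩
  · rw [Measure.map_apply hm (measurableSet_singleton _)]
    convert h0 using 2
    ext k; simp [hz]
  · rw [Measure.map_apply hm (measurableSet_range_intVec.diff (measurableSet_singleton _)).compl]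
    convert h0 using 2
    ext k; simp [hz]

/-- Every infinitely divisible law on `ℤⁿ` is the marginal law of a stationary trawl process. -/
theorem exists_stationary_trawlProcess (π : Measure (Fin n → ℤ)) [IsProbabilityMeasure π]
    (hπ : IsInfinitelyDivisibleInt π) {A : Set (I × ℝ)} (hA : IsTrawl A) (hpos : 0 < volume A) :
    ∃ (Ω : Type) (_ : MeasurableSpace Ω) (P : Measure Ω)
      (ν : Measure (EuclideanSpace ℝ (Fin n))) (N : Ω → Measure (JumpSpace n)),
      IsProbabilityMeasure P ∧ IsIntegerLevyMeasure ν ∧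
      IsPoissonRandomMeasure (jumpIntensity ν) N P ∧
      IsStationaryProcess (trawlProcess N (fun _ => A)) P ∧
      ∀ t : ℝ, P.map (trawlProcess N (fun _ => A) t) = π.map (intVec n) := by
  obtain ⟨η, hη, hη0, hchar⟩ := hπ.exists_compoundPoisson
  have hmi := measurable_intVec n
  set a : ℝ≥0 := (volume A).toNNReal with ha
  have ha0 : a ≠ 0 := by
    rw [ha, Ne, ENNReal.toNNReal_eq_zero_iff, not_or]
    exact ⟨hpos.ne', hA.volume_lt_top.ne⟩
  -- Dividing by `Leb(A)`, which is positive and finite, cancels the factor it contributes to the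
  -- marginal exponent.
  set η' : Measure (Fin n → ℤ) := a⁻¹ • η with hη'
  set ν := η'.map (intVec n) with hνdef
  have hν : IsIntegerLevyMeasure ν := isIntegerLevyMeasure_map_intVec (by simp [hη', hη0])
  have := hν.isFiniteMeasure
  have : SFinite (jumpIntensity ν) := by unfold jumpIntensity; infer_instance
  obtain ⟨Ω, mΩ, P, N, hP, hN⟩ := exists_isPoissonRandomMeasure (jumpIntensity ν)
  refine ⟨Ω, mΩ, P, ν, N, hP, hν, hN, isStationaryProcess_trawlProcess hν hN hA, fun t => ?_⟩
  have hY := aemeasurable_trawlProcess hν hN hA t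
  have := Measure.isProbabilityMeasure_map hY
  have : IsProbabilityMeasure (π.map (intVec n)) :=
    Measure.isProbabilityMeasure_map hmi.aemeasurable
  refine Measure.ext_of_charFun (funext fun θ => ?_)
  rw [hchar, charFun_apply, integral_map hY (by fun_prop)]
  have h := integral_exp_trawlProcess hν hN hA t θ
  have h2 : ((volume A).toReal : ℂ) * seedCumulant ν θ =
      ∫ k, (Complex.exp (Complex.I * ((inner ℝ θ (intVec n k) : ℝ) : ℂ)) - 1) ∂η := by
    rw [seedCumulant, hνdef, integral_map hmi.aemeasurable (by fun_prop), hη',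
      integral_smul_nnreal_measure, NNReal.smul_def, Complex.real_smul, ← mul_assoc,
      ← Complex.ofReal_mul]
    have h3 : (volume A).toReal * ((a⁻¹ : ℝ≥0) : ℝ) = 1 := by
      rw [NNReal.coe_inv]
      exact mul_inv_cancel₀ (NNReal.coe_ne_zero.2 ha0)
    rw [h3, Complex.ofReal_one, one_mul]
  rw [← h2, ← h]
  refine integral_congr_ae (ae_of_all _ fun ω => ?_)
  simp only [real_inner_comm, mul_comm]

end Trawl

theorem mainTheorem6 (n : ℕ) :
    (∀ (Ω : Type*) [MeasurableSpace Ω] (P : Measure Ω) [IsProbabilityMeasure P]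
        (ν : Measure (EuclideanSpace ℝ (Fin n))) (N : Ω → Measure (JumpSpace n))
        (A : Set (I × ℝ)),
        IsIntegerLevyMeasure ν → IsPoissonRandomMeasure (jumpIntensity ν) N P → IsTrawl A →
        ∀ t : ℝ,
          AEMeasurable (trawlProcess N (fun _ => A) t) P ∧
          ∀ θ : EuclideanSpace ℝ (Fin n),
            ∫ ω, Complex.exp
                (Complex.I * ((inner ℝ θ (trawlProcess N (fun _ => A) t ω) : ℝ) : ℂ)) ∂P =
              Complex.exp (((volume A).toReal : ℂ) * seedCumulant ν θ)) ∧
    (∀ (π : Measure (Fin n → ℤ)) [IsProbabilityMeasure π], IsInfinitelyDivisibleInt π →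
        ∀ A : Set (I × ℝ), IsTrawl A → 0 < volume A →
          ∃ (Ω : Type) (_ : MeasurableSpace Ω) (P : Measure Ω)
            (ν : Measure (EuclideanSpace ℝ (Fin n))) (N : Ω → Measure (JumpSpace n)),
            IsProbabilityMeasure P ∧ IsIntegerLevyMeasure ν ∧
            IsPoissonRandomMeasure (jumpIntensity ν) N P ∧
            IsStationaryProcess (trawlProcess N (fun _ => A)) P ∧
            ∀ t : ℝ, P.map (trawlProcess N (fun _ => A) t) = π.map (intVec n)) :=
  ⟨fun _ _ _ _ _ _ _ hν hN hA t => ⟨aemeasurable_trawlProcess hν hN hA t,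
    integral_exp_trawlProcess hν hN hA t⟩,
   fun π _ hπ _ hA hpos => exists_stationary_trawlProcess π hπ hA hpos⟩
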